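/- Let $q,s\in\mathbb C$ and define, for $x\in\mathbb C$ with $sx\neq 1$, integers $I,K\ge 0$ and $j,\ell\in\{0,1\}$, the vertex weights $$L_x(I,0;I,0)=\frac{1-sxq^{I}}{1-sx},\quad L_x(I,1;I,1)=\frac{x-sq^{I}}{1-sx},\quad L_x(I,1;I+1,0)=\frac{1-q^{I+1}}{1-sx},\quad L_x(I+1,0;I,1)=\frac{x(1-s^2q^{I})}{1-sx},$$ and $L_x(I,j;K,\ell)=0$ in all other cases (here $I,j,K,\ell$ are the numbers of paths on the bottom, left, top and right edge of a vertex). For a partition $\lambda$ let $m_i(\lambda)$ be the number of parts of $\lambda$ equal to $i$, and for partitions $\mu,\lambda$ put $$\langle\mu|\mathcal T(x)|\lambda\rangle=\sum_{h}\ \prod_{i\ge 1}L_x\bigl(m_i(\mu),h_{i};m_i(\lambda),h_{i-1}\bigr),$$ where the sum is over all sequences $h=(h_0,h_1,h_2,\dots)$ in $\{0,1\}$ with $h_i=0$ for all large $i$ ($h_0$ is free). The stable spin Hall--Littlewood function is $$f_\lambda(x_1,\dots,x_n)=\langle\lambda|\mathcal T(x_n)\cdots\mathcal T(x_2)\mathcal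 T(x_1)|\varnothing\rangle ,$$ the product being that of matrices indexed by partitions (all sums involved have finitely many non-zero terms). Suppose that $s^2q^{2k-1}\neq 1$ for all $k\ge 1$, and for a partition $\lambda$ put $$b^{el}_\lambda=\prod_{i\ge 1}\ \prod_{k=1}^{\lfloor m_i(\lambda)/2\rfloor}\frac{1-q^{2k-1}}{1-s^2q^{2k-1}} .$$ Let $n\ge 0$ and let $x_1,\dots,x_n\in\mathbb C$ satisfy $sx_i\ne 1$ for all $i$ and $$\bigl|(x_i-s)(x_j-s)\bigr|<\bigl|(1-sx_i)(1-sx_j)\bigr|\qquad\text{for all }1\le i<j\le n.$$ Then $$\sum_{\lambda'\text{ even}} b^{el}_\lambda\, f_\lambda(x_1,\dots,x_n)=\prod_{1\le i<j\le n}\frac{1-q\,x_ix_j}{1-x_ix_j},$$ where the sum is over all partitions $\lambda$ whose conjugate $\lambda'$ has only even parts, and it converges absolutely. -/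

import Mathlib

noncomputable section

namespace SpinHallLittlewood

/-- The Boltzmann weight `L_{x,s}(I, j; K, ℓ)` of a vertex with horizontal spectral parameter `x`:
`I` paths on the bottom edge, `j` on the left edge, `K` on the top edge, `ℓ` on the right edge
(paths are directed from South-West to North-East). -/
def vertexWeight (q s x : ℂ) (I : ℕ) (j : Fin 2) (K : ℕ) (ℓ : Fin 2) : ℂ :=
  if j = 0 ∧ ℓ = 0 ∧ K = I then (1 - s * x * q ^ I) / (1 - s * x)
  else if j = 1 ∧ ℓ = 1 ∧ K = I then (x - s * q ^ I) / (1 - s * x)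
  else if j = 1 ∧ ℓ = 0 ∧ K = I + 1 then (1 - q ^ (I + 1)) / (1 - s * x)
  else if j = 0 ∧ ℓ = 1 ∧ I = K + 1 then x * (1 - s ^ 2 * q ^ K) / (1 - s * x)
  else 0

/-- Occupation numbers of the vertical lines, labelling the basis vectors
`|K₁⟩ ⊗ |K₂⟩ ⊗ |K₃⟩ ⊗ ⋯` with finitely many non-zero `Kᵢ`. The columns are numbered `1, 2, 3, …`
from right to left, and `K i` is the number of paths in the column number `i + 1`. -/
abbrev Occupation : Type := ℕ →₀ ℕ

/-- The one-row partition function with bottom edges `I`, top edges `K`, no path entering from the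
left at infinity, and `ℓ` paths leaving on the right. It is the sum over all assignments `h` of the
horizontal edges, where `h i` is the edge to the right of the column number `i + 1` and
`h (i + 1)` is the edge to its left; `h` is eventually zero because the left boundary is empty. -/
def rowWeight (q s x : ℂ) (ℓ : Fin 2) (I K : Occupation) : ℂ :=
  ∑ᶠ h : {h : ℕ →₀ Fin 2 // h 0 = ℓ},
    ∏ᶠ i : ℕ, vertexWeight q s x (I i) (h.1 (i + 1)) (K i) (h.1 i)

/-- The row operator `𝒯(x) = T₀(x) + T₁(x)`, acting on (possibly infinite) formal linear
combinations of the basis vectors, given by their coefficients: the coefficient of `⟨I|` in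
`𝒯(x) v` is the sum over `K` of `⟨I| 𝒯(x) |K⟩` times the coefficient of `|K⟩` in `v`. For a given
bottom `I` only finitely many tops `K` contribute. -/
def rowOperator (q s x : ℂ) (v : Occupation → ℂ) : Occupation → ℂ :=
  fun I => ∑ᶠ K : Occupation, (rowWeight q s x 0 I K + rowWeight q s x 1 I K) * v K

/-- The multiplicity `m_i(lam)` of `i` as a part of the partition `lam`: the number of rows of
length `i` of its diagram. -/
def partMultiplicity (lam : YoungDiagram) (i : ℕ) : ℕ := lam.rowLens.count i

/-- The occupation numbers of the basis vector `|lam⟩`, where `lam = 1^{m₁} 2^{m₂} ⋯`: there are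
`m_i(lam)` paths in the column number `i`. -/
def occupation (lam : YoungDiagram) : Occupation :=
  Finsupp.ofSupportFinite (fun i => partMultiplicity lam (i + 1)) <| by
    refine ((lam.rowLens.toFinset.finite_toSet).preimage
      (Set.injOn_of_injective Nat.succ_injective)).subset fun i hi => ?_
    have h : lam.rowLens.count (i + 1) ≠ 0 := hi
    simpa [List.count_eq_zero] using h

/-- The coefficients of the basis vector `|lam⟩`. -/
def ket (lam : YoungDiagram) : Occupation → ℂ := Pi.single (occupation lam) 1

/-- The skew stable spin Hall-Littlewood function
`f_{mu/lam}(x₁, …, xₙ) = ⟨mu| 𝒯(xₙ) ⋯ 𝒯(x₂) 𝒯(x₁) |lam⟩`. -/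
def skewF (q s : ℂ) (mu lam : YoungDiagram) {n : ℕ} (x : Fin n → ℂ) : ℂ :=
  (List.ofFn x).foldl (fun v y => rowOperator q s y v) (ket lam) (occupation mu)

/-- The stable spin Hall-Littlewood function `f_{mu} = f_{mu/∅}`. -/
def nonSkewF (q s : ℂ) (mu : YoungDiagram) {n : ℕ} (x : Fin n → ℂ) : ℂ :=
  skewF q s mu ⊥ x

/-- A partition is even if all its parts are even. -/
def IsEvenPartition (lam : YoungDiagram) : Prop := ∀ i, Even (lam.rowLen i)

/-- The coefficient `b^{el}_{lam} = ∏_{i ≥ 1} ∏_{k=1}^{m_i/2} (1 - q^{2k-1}) / (1 - s² q^{2k-1})`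
with `m_i = m_i(lam)`. The product runs over the finitely many `i ≥ 1` with `m_i ≠ 0`. -/
def bEl (q s : ℂ) (lam : YoungDiagram) : ℂ :=
  (occupation lam).prod fun _ m =>
    ∏ k ∈ Finset.Icc 1 (m / 2), (1 - q ^ (2 * k - 1)) / (1 - s ^ 2 * q ^ (2 * k - 1))

end SpinHallLittlewood

end

/-! ### Vertex operators, dual rows and the Yang-Baxter equation. -/

noncomputable section

namespace SpinHallLittlewood

/-! A partition with even conjugate is a sequence of even column occupations. The left-hand side is
therefore a partition function of `n` rows with empty left and top boundary, free right boundary,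
and the vector `∑ₖ evenCoeff k ⟨2k|` at the bottom of every column. Read by columns instead of rows,
the sum over the first `N` columns is the `N`-th power of one operator, `evenColumn`, on functions
of the `n` horizontal edges, applied to the indicator of the empty state (`partialSum_succ`,
`partialSum_zero`).

A fixed vector of this operator is built by reflection. The coefficients `evenCoeff` are such that,
at the even boundary, the bottom row may be replaced by a dual row with reversed paths
(`sum_evenCoeff_mul_vertexOp`). The Yang-Baxter equation lifts the dual row through the other rows
to the empty top, where it becomes trivial (`dualVertexOp_column_transport`). Hence `fixedVector`,
assembled from one crossing for each pair of rows, is fixed (`evenColumn_fixedVector`). The outgoing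
weights of a crossing sum to `(1 - qzy) / (1 - zy)` for every incoming state, so the entries of
`fixedVector` sum to the product on the right-hand side (`total_fixedVector`).

The iterates converge to this vector because the operator is triangular. Its diagonal entry at a
state is the product of `(z - s) / (1 - sz)` over the occupied edges. States with an odd number of
occupied edges never occur. On non-empty even states the factors can be paired, and the inequality
assumed for pairs makes the modulus less than 1. At the empty state both vectors equal 1. So the
error tends to 0 (`tendsto_partialSum`), and the same recursion applied to sums of norms gives
absolute convergence (`bounded_sum_norm`). -/

/-- The action of a vertex on functions of the vertical occupation number. -/
def vertexOp (q s x : ℂ) (j l : Fin 2) (f : ℕ → ℂ) (I : ℕ) : ℂ :=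
  ∑ K ∈ Finset.range (I + 2), vertexWeight q s x I j K l * f K

theorem vertexOp_zero_zero (q s x : ℂ) (f : ℕ → ℂ) (I : ℕ) :
    vertexOp q s x 0 0 f I = (1 - s * x * q ^ I) / (1 - s * x) * f I := by
  rw [vertexOp, Finset.sum_eq_single I] <;> simp +contextual [vertexWeight]

theorem vertexOp_one_one (q s x : ℂ) (f : ℕ → ℂ) (I : ℕ) :
    vertexOp q s x 1 1 f I = (x - s * q ^ I) / (1 - s * x) * f I := by
  rw [vertexOp, Finset.sum_eq_single I] <;> simp +contextual [vertexWeight]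

theorem vertexOp_one_zero (q s x : ℂ) (f : ℕ → ℂ) (I : ℕ) :
    vertexOp q s x 1 0 f I = (1 - q ^ (I + 1)) / (1 - s * x) * f (I + 1) := by
  rw [vertexOp, Finset.sum_eq_single (I + 1)] <;> simp +contextual [vertexWeight]

theorem vertexOp_zero_one_zero (q s x : ℂ) (f : ℕ → ℂ) :
    vertexOp q s x 0 1 f 0 = 0 := by
  simp [vertexOp, vertexWeight]

theorem vertexOp_zero_one_succ (q s x : ℂ) (f : ℕ → ℂ) (I : ℕ) :
    vertexOp q s x 0 1 f (I + 1) = x * (1 - s ^ 2 * q ^ I) / (1 - s * x) * f I := by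
  rw [vertexOp, Finset.sum_eq_single I]
  · simp [vertexWeight]
  · intro K _ hK
    simp [vertexWeight, hK.symm]
  · intro h
    exact absurd (Finset.mem_range.2 (by omega)) h

/-- The action of a vertex of the dual row, whose path enters on the right (`r`) and leaves on the
left (`p`). -/
def dualVertexOp (q s y : ℂ) (p r : Fin 2) (f : ℕ → ℂ) (I : ℕ) : ℂ :=
  if p = 0 ∧ r = 0 then (1 - s * y * q ^ I) / (1 - s * y) * f I
  else if p = 1 ∧ r = 1 then (y - s * q ^ I) / (1 - s * y) * f I
  else if p = 1 ∧ r = 0 then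
    if I = 0 then 0 else (1 - s ^ 2 * q ^ (I - 1)) / (1 - s * y) * f (I - 1)
  else y * (1 - q ^ (I + 1)) / (1 - s * y) * f (I + 1)

theorem dualVertexOp_zero_zero (q s y : ℂ) (f : ℕ → ℂ) (I : ℕ) :
    dualVertexOp q s y 0 0 f I = (1 - s * y * q ^ I) / (1 - s * y) * f I := by
  simp [dualVertexOp]

theorem dualVertexOp_one_one (q s y : ℂ) (f : ℕ → ℂ) (I : ℕ) :
    dualVertexOp q s y 1 1 f I = (y - s * q ^ I) / (1 - s * y) * f I := by
  simp [dualVertexOp]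

theorem dualVertexOp_zero_one (q s y : ℂ) (f : ℕ → ℂ) (I : ℕ) :
    dualVertexOp q s y 0 1 f I = y * (1 - q ^ (I + 1)) / (1 - s * y) * f (I + 1) := by
  simp [dualVertexOp]

theorem dualVertexOp_one_zero_zero (q s y : ℂ) (f : ℕ → ℂ) :
    dualVertexOp q s y 1 0 f 0 = 0 := by
  simp [dualVertexOp]

theorem dualVertexOp_one_zero_succ (q s y : ℂ) (f : ℕ → ℂ) (I : ℕ) :
    dualVertexOp q s y 1 0 f (I + 1) = (1 - s ^ 2 * q ^ I) / (1 - s * y) * f I := by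
  simp [dualVertexOp]

/-- The weights of the crossing of a row with parameter `z` and a dual row with parameter `y`; the
state `(t, d)` is carried to `(t', d')`. -/
def crossWeight (q z y : ℂ) (t' d' t d : Fin 2) : ℂ :=
  (if t = d then
    if t' = d' then
      if t = 0 then (if t' = 0 then 1 - z * y else (1 - q) * z * y)
      else (if t' = 0 then 1 - q else q * (1 - z * y))
    else 0
  else if t' = t ∧ d' = d then 1 - q * z * y else 0) * (1 - z * y)⁻¹

/-- The Yang-Baxter equation for a row and a dual row. -/
theorem yangBaxter (q s z y : ℂ) (t' d' t d : Fin 2) (f : ℕ → ℂ) (I : ℕ) :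
    ∑ t₁, ∑ d₁, crossWeight q z y t₁ d₁ t d *
        dualVertexOp q s y d₁ d' (vertexOp q s z t₁ t' f) I =
      ∑ t₁, ∑ d₁, crossWeight q z y t' d' t₁ d₁ *
        vertexOp q s z t t₁ (dualVertexOp q s y d d₁ f) I := by
  simp only [Fin.sum_univ_two, crossWeight]
  -- The normalisation is a common factor of both sides, so it may be any constant and `z * y ≠ 1`
  -- is not needed.
  generalize (1 - z * y)⁻¹ = c
  revert t' d' t d
  simp only [Fin.forall_fin_two]
  -- A row and a dual row can together lower the occupation by two, so `I = 0` and `I = 1` are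
  -- boundary cases.
  rcases I with _ | _ | I <;>
  refine ⟨⟨⟨⟨?_, ?_⟩, ?_, ?_⟩, ⟨?_, ?_⟩, ?_, ?_⟩, ⟨⟨?_, ?_⟩, ?_, ?_⟩, ⟨?_, ?_⟩, ?_, ?_⟩ <;>
  simp only [vertexOp_zero_zero, vertexOp_one_one, vertexOp_one_zero,
    vertexOp_zero_one_zero, vertexOp_zero_one_succ, dualVertexOp_zero_zero, dualVertexOp_one_one,
    dualVertexOp_zero_one, dualVertexOp_one_zero_zero, dualVertexOp_one_zero_succ,
    div_eq_mul_inv, if_true, if_false, one_ne_zero, zero_ne_one, and_true, and_false] <;>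
  ring

end SpinHallLittlewood

end

/-! ### Columns, reflection at the even boundary and the fixed vector. -/

noncomputable section

namespace SpinHallLittlewood

open Finset

theorem vertexOp_sum {ι : Type*} (q s x : ℂ) (j l : Fin 2) (S : Finset ι) (c : ι → ℂ)
    (f : ι → ℕ → ℂ) (I : ℕ) :
    vertexOp q s x j l (fun K => ∑ i ∈ S, c i * f i K) I =
      ∑ i ∈ S, c i * vertexOp q s x j l (f i) I := by
  simp only [vertexOp, mul_sum]
  rw [sum_comm]
  exact sum_congr rfl fun i _ => sum_congr rfl fun K _ => by ring

theorem dualVertexOp_sum {ι : Type*} (q s x : ℂ) (j l : Fin 2) (S : Finset ι) (c : ι → ℂ)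
    (f : ι → ℕ → ℂ) (I : ℕ) :
    dualVertexOp q s x j l (fun K => ∑ i ∈ S, c i * f i K) I =
      ∑ i ∈ S, c i * dualVertexOp q s x j l (f i) I := by
  unfold dualVertexOp
  split_ifs <;> simp only [mul_sum, mul_zero, sum_const_zero] <;>
    exact sum_congr rfl fun i _ => by ring

/-- The partition function of one column with the rows `ys` (bottom row first), empty top edge and
bottom edge `I`, acting on functions of the left edges; `h` is the list of right edges. -/
def column (q s : ℂ) : List ℂ → (List (Fin 2) → ℂ) → List (Fin 2) → ℕ → ℂ
  | [], v, h => fun I => if I = 0 then v h else 0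
  | _ :: _, _, [] => fun _ => 0
  | z :: ys, v, a' :: h' => fun I =>
      ∑ a, vertexOp q s z a a' (column q s ys (fun h => v (a :: h)) h') I

theorem column_sum {ι : Type*} (q s : ℂ) (S : Finset ι) (c : ι → ℂ) (ys : List ℂ) :
    ∀ (v : ι → List (Fin 2) → ℂ) (h : List (Fin 2)) (I : ℕ),
    column q s ys (fun h => ∑ i ∈ S, c i * v i h) h I = ∑ i ∈ S, c i * column q s ys (v i) h I := by
  induction ys with
  | nil =>
    intro v h I
    by_cases hI : I = 0 <;> simp [column, hI]
  | cons z ys ih =>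
    rintro v (_ | ⟨a', h'⟩) I
    · simp [column]
    · simp only [column, mul_sum]
      rw [sum_comm]
      refine sum_congr rfl fun a _ => ?_
      rw [← vertexOp_sum]
      congr 1
      funext K
      exact ih (fun i h => v i (a :: h)) h' K

theorem vertexOp_zero_fun {q s x : ℂ} {j l : Fin 2} {f : ℕ → ℂ} {I : ℕ}
    (hf : ∀ K, I ≤ K + 1 → f K = 0) : vertexOp q s x j l f I = 0 := by
  refine sum_eq_zero fun K _ => ?_
  by_cases h : I ≤ K + 1
  · rw [hf K h, mul_zero]
  · have : vertexWeight q s x I j K l = 0 := by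
      unfold vertexWeight
      split_ifs <;> first | rfl | omega
    rw [this, zero_mul]

/-- Each row carries at most one path out of the column, and none leaves through the top. -/
theorem column_eq_zero_of_length_lt (q s : ℂ) (ys : List ℂ) :
    ∀ (v : List (Fin 2) → ℂ) (h : List (Fin 2)) (I : ℕ), ys.length < I →
      column q s ys v h I = 0 := by
  induction ys with
  | nil =>
    intro v h I hI
    simp only [List.length_nil] at hI
    simp [column, hI.ne']
  | cons z ys ih =>
    rintro v (_ | ⟨a', h'⟩) I hI
    · simp [column]
    · simp only [List.length_cons] at hI
      simp only [column]
      exact sum_eq_zero fun a _ => vertexOp_zero_fun fun K hK => ih _ _ _ (by omega)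

/-- The product of crossings carrying an empty dual row with parameter `y` from the top to the
bottom of the rows `ys`; `d` is the final state of the dual row. -/
def transport (q : ℂ) (y : ℂ) : List ℂ → (List (Fin 2) → ℂ) → Fin 2 → List (Fin 2) → ℂ
  | [], v, d, h => if d = 0 then v h else 0
  | _ :: _, _, _, [] => 0
  | z :: ys, v, d', a' :: h' =>
      ∑ p : Fin 2 × Fin 2, crossWeight q z y a' d' p.1 p.2 *
        transport q y ys (fun h => v (p.1 :: h)) p.2 h'

theorem transport_sum {ι : Type*} (q y : ℂ) (S : Finset ι) (c : ι → ℂ) (ys : List ℂ) :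
    ∀ (v : ι → List (Fin 2) → ℂ) (d : Fin 2) (h : List (Fin 2)),
    transport q y ys (fun h => ∑ i ∈ S, c i * v i h) d h =
      ∑ i ∈ S, c i * transport q y ys (v i) d h := by
  induction ys with
  | nil =>
    intro v d h
    by_cases hd : d = 0 <;> simp [transport, hd]
  | cons z ys ih =>
    rintro v d (_ | ⟨a', h'⟩)
    · simp [transport]
    · simp only [transport, mul_sum]
      rw [sum_comm]
      refine sum_congr rfl fun p _ => ?_
      rw [ih (fun i h => v i (p.1 :: h)) p.2 h', mul_sum]
      exact sum_congr rfl fun i _ => by ring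

theorem yangBaxter_pair (q s z y : ℂ) (t' d' t d : Fin 2) (f : ℕ → ℂ) (I : ℕ) :
    ∑ p : Fin 2 × Fin 2, crossWeight q z y p.1 p.2 t d *
        dualVertexOp q s y p.2 d' (vertexOp q s z p.1 t' f) I =
      ∑ p : Fin 2 × Fin 2, crossWeight q z y t' d' p.1 p.2 *
        vertexOp q s z t p.1 (dualVertexOp q s y d p.2 f) I := by
  simpa only [Fintype.sum_prod_type] using yangBaxter q s z y t' d' t d f I

/-- Moving a dual row through a column. -/
theorem dualVertexOp_column_transport {q s y : ℂ} (hy : s * y ≠ 1) (ys : List ℂ) :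
    ∀ (v : List (Fin 2) → ℂ) (d' : Fin 2) (h : List (Fin 2)) (I : ℕ),
    ∑ d, dualVertexOp q s y d d' (column q s ys (transport q y ys v d) h) I =
      transport q y ys (fun h => column q s ys v h I) d' h := by
  induction ys with
  | nil =>
    intro v d' h I
    have hy' : 1 - s * y ≠ 0 := sub_ne_zero.2 hy.symm
    -- Below the empty top edge, a dual vertex with empty left edge has weight 1 if its bottom and
    -- right edges are empty, and vanishes otherwise.
    rcases I with _ | _ | I <;> revert d' <;>
    simp [column, transport, dualVertexOp, hy']
  | cons z ys ih =>
    rintro v d' (_ | ⟨a', h'⟩) I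
    · simp only [column, transport]
      exact sum_eq_zero fun d _ => by simp [dualVertexOp]
    · have hcol : ∀ (a d : Fin 2) (K : ℕ),
          column q s ys (fun h => transport q y (z :: ys) v d (a :: h)) h' K =
            ∑ p : Fin 2 × Fin 2, crossWeight q z y a d p.1 p.2 *
              column q s ys (transport q y ys (fun h => v (p.1 :: h)) p.2) h' K := by
        intro a d K
        rw [← column_sum]
        rfl
      have hL : ∀ d K, column q s (z :: ys) (transport q y (z :: ys) v d) (a' :: h') K =
          ∑ a, (1 : ℂ) * ∑ p : Fin 2 × Fin 2, crossWeight q z y a d p.1 p.2 *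
            vertexOp q s z a a'
              (column q s ys (transport q y ys (fun h => v (p.1 :: h)) p.2) h') K := by
        intro d K
        simp only [column, one_mul]
        refine sum_congr rfl fun a _ => ?_
        rw [← vertexOp_sum]
        congr 1
        funext K
        exact hcol a d K
      have hR : ∀ p : Fin 2 × Fin 2,
          transport q y ys (fun h => column q s (z :: ys) v (p.1 :: h) I) p.2 h' =
            ∑ r : Fin 2 × Fin 2, vertexOp q s z r.1 p.1 (dualVertexOp q s y r.2 p.2
              (column q s ys (transport q y ys (fun h => v (r.1 :: h)) r.2) h')) I := by
        intro p
        have e1 : (fun h => column q s (z :: ys) v (p.1 :: h) I) = fun h =>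
            ∑ a, (1 : ℂ) * ∑ K ∈ range (I + 2), vertexWeight q s z I a K p.1 *
              column q s ys (fun h => v (a :: h)) h K := by
          funext h
          simp only [column, vertexOp, one_mul]
        rw [e1, transport_sum, Fintype.sum_prod_type]
        refine sum_congr rfl fun a _ => ?_
        rw [one_mul, transport_sum]
        simp only [← ih]
        change vertexOp q s z a p.1 _ I = _
        have := vertexOp_sum q s z a p.1 univ (fun _ => 1) (fun d : Fin 2 =>
          dualVertexOp q s y d p.2
            (column q s ys (transport q y ys (fun h => v (a :: h)) d) h')) I
        simpa only [one_mul] using this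
      have e2 : ∀ d, column q s (z :: ys) (transport q y (z :: ys) v d) (a' :: h') = _ :=
        fun d => funext (hL d)
      simp only [e2, dualVertexOp_sum]
      simp only [transport, hR, one_mul]
      have e3 : ∀ p : Fin 2 × Fin 2, _ := fun p =>
        yangBaxter_pair q s z y a' d' p.1 p.2
          (column q s ys (transport q y ys (fun h => v (p.1 :: h)) p.2) h') I
      simp only [mul_sum]
      rw [sum_comm (s := (univ : Finset (Fin 2 × Fin 2)))]
      simp only [← e3, Fintype.sum_prod_type, Fin.sum_univ_two]
      ring

/-- The coefficient `∏_{i ≤ k} (1 - q^{2i-1}) / (1 - s² q^{2i-1})`. -/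
def evenCoeff (q s : ℂ) (k : ℕ) : ℂ :=
  ∏ i ∈ Icc 1 k, (1 - q ^ (2 * i - 1)) / (1 - s ^ 2 * q ^ (2 * i - 1))

theorem evenCoeff_zero (q s : ℂ) : evenCoeff q s 0 = 1 := by simp [evenCoeff]

theorem evenCoeff_succ (q s : ℂ) (k : ℕ) : evenCoeff q s (k + 1) =
    evenCoeff q s k * ((1 - q ^ (2 * k + 1)) / (1 - s ^ 2 * q ^ (2 * k + 1))) := by
  rw [evenCoeff, prod_Icc_succ_top (by omega)]
  rfl

/-- Reflection of a row at the even boundary. -/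
theorem sum_evenCoeff_mul_vertexOp {q s : ℂ}
    (hb : ∀ k : ℕ, 1 ≤ k → s ^ 2 * q ^ (2 * k - 1) ≠ 1) (x : ℂ) (j l : Fin 2) (f : ℕ → ℂ) (N : ℕ)
    (hf : ∀ K, 2 * N < K → f K = 0) :
    ∑ k ∈ range (N + 1), evenCoeff q s k * vertexOp q s x j l f (2 * k) =
      ∑ k ∈ range (N + 1), evenCoeff q s k * dualVertexOp q s x j l f (2 * k) := by
  have hd : ∀ k, 1 - s ^ 2 * q ^ (2 * k + 1) ≠ 0 := fun k =>
    sub_ne_zero.2 (hb (k + 1) (by omega)).symm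
  revert j l
  simp only [Fin.forall_fin_two]
  refine ⟨⟨?_, ?_⟩, ?_, ?_⟩
  · simp only [vertexOp_zero_zero, dualVertexOp_zero_zero]
  -- The term `k + 1` on the left matches the term `k` on the right: the ratio of consecutive
  -- coefficients trades `1 - s² q^(2k+1)` for `1 - q^(2k+1)`. The unmatched end terms vanish, by
  -- emptiness of the vertex and by `hf`.
  · rw [sum_range_succ', sum_range_succ]
    simp only [mul_zero, vertexOp_zero_one_zero, dualVertexOp_zero_one,
      hf (2 * N + 1) (by omega), add_zero]
    refine sum_congr rfl fun k _ => ?_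
    rw [show 2 * (k + 1) = 2 * k + 1 + 1 by ring, vertexOp_zero_one_succ, evenCoeff_succ]
    have : 1 - q ^ (2 * k + 1) * s ^ 2 ≠ 0 := by rw [mul_comm]; exact hd k
    field_simp
  · rw [sum_range_succ, sum_range_succ']
    simp only [mul_zero, dualVertexOp_one_zero_zero, vertexOp_one_zero,
      hf (2 * N + 1) (by omega), add_zero]
    refine sum_congr rfl fun k _ => ?_
    rw [show 2 * (k + 1) = 2 * k + 1 + 1 by ring, dualVertexOp_one_zero_succ, evenCoeff_succ]
    have : 1 - q ^ (2 * k + 1) * s ^ 2 ≠ 0 := by rw [mul_comm]; exact hd k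
    field_simp
  · simp only [vertexOp_one_one, dualVertexOp_one_one]

/-- The column with even bottom edge, weighted by the coefficients of the even boundary. -/
def evenColumn (q s : ℂ) (N : ℕ) (ys : List ℂ) (v : List (Fin 2) → ℂ) (h : List (Fin 2)) : ℂ :=
  ∑ k ∈ range (N + 1), evenCoeff q s k * column q s ys v h (2 * k)

/-- The vector fixed by `evenColumn`. -/
def fixedVector (q : ℂ) : List ℂ → List (Fin 2) → ℂ
  | [], h => if h = [] then 1 else 0
  | _ :: _, [] => 0
  | y :: ys, a :: h => transport q y ys (fixedVector q ys) a h

/-- Reflection turns the bottom row into a dual row, and moving it to the top pulls `transport` out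
of the column. What remains is the even column of the other rows, which fixes their vector by
induction. The bound on the length ensures that the truncation at `2 * N` loses nothing in the
reflection. -/
theorem evenColumn_fixedVector {q s : ℂ}
    (hb : ∀ k : ℕ, 1 ≤ k → s ^ 2 * q ^ (2 * k - 1) ≠ 1) (N : ℕ) (ys : List ℂ)
    (hs : ∀ y ∈ ys, s * y ≠ 1) (hN : ys.length ≤ 2 * N + 1) (h : List (Fin 2)) :
    evenColumn q s N ys (fixedVector q ys) h = fixedVector q ys h := by
  induction ys generalizing h with
  | nil =>
    rw [evenColumn, sum_eq_single 0]
    · simp [evenCoeff_zero, column]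
    · intro k _ hk
      simp [column, hk]
    · simp
  | cons y ys ih =>
    rcases h with _ | ⟨a', h'⟩
    · simp [evenColumn, column, fixedVector]
    · simp only [evenColumn, column, mul_sum]
      rw [sum_comm]
      have e : ∀ a, _ := fun a => sum_evenCoeff_mul_vertexOp hb y a a'
        (column q s ys (fun h => fixedVector q (y :: ys) (a :: h)) h') N
        fun K hK => column_eq_zero_of_length_lt q s ys _ _ _
          (by simp only [List.length_cons] at hN; omega)
      simp only [e]
      rw [sum_comm]
      simp only [← mul_sum]
      have e' := dualVertexOp_column_transport (q := q) (hs y (by simp)) ys (fixedVector q ys) a' h'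
      simp only [fixedVector] at *
      simp only [e', ← transport_sum]
      have : (fun h => ∑ k ∈ range (N + 1), evenCoeff q s k *
          column q s ys (fixedVector q ys) h (2 * k)) = fixedVector q ys := by
        funext h
        exact ih (fun y hy => hs y (by simp [hy])) (by simp only [List.length_cons] at hN; omega) h
      rw [this]

/-- The sum of the values of `v` on all lists of length `n`. -/
def total : ℕ → (List (Fin 2) → ℂ) → ℂ
  | 0, v => v []
  | n + 1, v => ∑ a, total n fun h => v (a :: h)

theorem total_sum {ι : Type*} (n : ℕ) (S : Finset ι) (c : ι → ℂ) : ∀ (v : ι → List (Fin 2) → ℂ),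
    total n (fun h => ∑ i ∈ S, c i * v i h) = ∑ i ∈ S, c i * total n (v i) := by
  induction n with
  | zero => intro v; rfl
  | succ n ih =>
    intro v
    simp only [total, mul_sum]
    rw [sum_comm]
    exact sum_congr rfl fun a _ => ih fun i h => v i (a :: h)

theorem sum_crossWeight (q z y : ℂ) (hzy : z * y ≠ 1) (t d : Fin 2) :
    ∑ p : Fin 2 × Fin 2, crossWeight q z y p.1 p.2 t d = (1 - q * z * y) / (1 - z * y) := by
  have : 1 - z * y ≠ 0 := sub_ne_zero.2 hzy.symm
  revert t d
  simp only [Fin.forall_fin_two, Fintype.sum_prod_type, Fin.sum_univ_two]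
  refine ⟨⟨?_, ?_⟩, ?_, ?_⟩ <;> simp [crossWeight] <;> field_simp <;> ring

/-- Summed over its outgoing states, a crossing becomes a scalar that does not depend on the
incoming ones, so the crossings peel off starting from the bottom row. -/
theorem total_transport (q y : ℂ) (ys : List ℂ) (hy : ∀ z ∈ ys, z * y ≠ 1) :
    ∀ v : List (Fin 2) → ℂ, ∑ d, total ys.length (transport q y ys v d) =
      (ys.map fun z => (1 - q * z * y) / (1 - z * y)).prod * total ys.length v := by
  induction ys with
  | nil => intro v; simp [total, transport]
  | cons z ys ih =>
    intro v
    have e : ∀ d a, total ys.length (fun h => transport q y (z :: ys) v d (a :: h)) =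
        ∑ p : Fin 2 × Fin 2, crossWeight q z y a d p.1 p.2 *
          total ys.length (transport q y ys (fun h => v (p.1 :: h)) p.2) := by
      intro d a
      rw [← total_sum]
      rfl
    simp only [List.length_cons, total, e, List.map_cons, List.prod_cons]
    have ih' := ih fun z hz => hy z (by simp [hz])
    have e2 : ∀ t d, _ := fun t d => sum_crossWeight q z y (hy z (by simp)) t d
    rw [mul_assoc, mul_sum, mul_sum]
    simp only [← ih']
    simp only [Fintype.sum_prod_type, Fin.sum_univ_two] at e2 ⊢
    linear_combination
      total ys.length (transport q y ys (fun h => v (0 :: h)) 0) * e2 0 0 +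
      total ys.length (transport q y ys (fun h => v (0 :: h)) 1) * e2 0 1 +
      total ys.length (transport q y ys (fun h => v (1 :: h)) 0) * e2 1 0 +
      total ys.length (transport q y ys (fun h => v (1 :: h)) 1) * e2 1 1

/-- The right-hand side of the Littlewood identity. -/
def pairProduct (q : ℂ) : List ℂ → ℂ
  | [] => 1
  | y :: ys => (ys.map fun z => (1 - q * z * y) / (1 - z * y)).prod * pairProduct q ys

/-- The first edge of a state is the final state of the dual row, so the total is the sum over `d`
in `total_transport`. -/
theorem total_fixedVector (q : ℂ) (ys : List ℂ) (hy : ys.Pairwise fun y z => z * y ≠ 1) :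
    total ys.length (fixedVector q ys) = pairProduct q ys := by
  induction ys with
  | nil => rfl
  | cons y ys ih =>
    rw [List.pairwise_cons] at hy
    rw [pairProduct, ← ih hy.2, ← total_transport q y ys hy.1]
    rfl

/-- The outgoing pair `(0, 1)` arises only from `(0, 1)`, so the dual row would have to be occupied
from the start, whereas it starts empty. -/
theorem transport_one_replicate (q y : ℂ) (ys : List ℂ) : ∀ v : List (Fin 2) → ℂ,
    transport q y ys v 1 (List.replicate ys.length 0) = 0 := by
  induction ys with
  | nil => intro v; rfl
  | cons z ys ih =>
    intro v
    simp [transport, List.replicate_succ, Fintype.sum_prod_type, ih, crossWeight]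

theorem transport_zero_replicate (q y : ℂ) (ys : List ℂ) (hy : ∀ z ∈ ys, z * y ≠ 1) :
    ∀ v : List (Fin 2) → ℂ, transport q y ys v 0 (List.replicate ys.length 0) =
      v (List.replicate ys.length 0) := by
  induction ys with
  | nil => intro v; rfl
  | cons z ys ih =>
    intro v
    have : 1 - z * y ≠ 0 := sub_ne_zero.2 (hy z (by simp)).symm
    simp [transport, List.replicate_succ, Fintype.sum_prod_type, transport_one_replicate,
      crossWeight, ih fun z hz => hy z (by simp [hz]), this]

theorem fixedVector_replicate (q : ℂ) (ys : List ℂ) (hy : ys.Pairwise fun y z => z * y ≠ 1) :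
    fixedVector q ys (List.replicate ys.length 0) = 1 := by
  induction ys with
  | nil => rfl
  | cons y ys ih =>
    rw [List.pairwise_cons] at hy
    rw [← ih hy.2, ← transport_zero_replicate q y ys hy.1 (fixedVector q ys)]
    rfl

/-- The number of occupied edges. -/
def edgeCount : List (Fin 2) → ℕ
  | [] => 0
  | a :: h => a + edgeCount h

/-- A crossing changes the number of occupied edges by 0 or 2 in absolute value. The offset `m`
records the edges already stripped from the argument of `v`. -/
theorem transport_eq_zero_of_parity (q y : ℂ) (ys : List ℂ) :
    ∀ (m : ℕ) (v : List (Fin 2) → ℂ) (_ : ∀ h, (edgeCount h + m) % 2 = 1 → v h = 0)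
      (d : Fin 2) (h : List (Fin 2)), (edgeCount h + d + m) % 2 = 1 → transport q y ys v d h = 0 := by
  induction ys with
  | nil =>
    intro m v hv d h hd
    by_cases h0 : d = 0
    · subst h0
      simpa [transport] using hv h (by simpa using hd)
    · simp [transport, h0]
  | cons z ys ih =>
    rintro m v hv d (_ | ⟨a, h⟩) hd
    · rfl
    · simp only [transport]
      refine sum_eq_zero fun p _ => ?_
      by_cases hp : (edgeCount h + p.2 + (m + p.1)) % 2 = 1
      · rw [ih (m + p.1) _ (fun h hh => hv _ (by simp only [edgeCount]; omega)) _ _ hp, mul_zero]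
      · have : crossWeight q z y a d p.1 p.2 = 0 := by
          obtain ⟨t, u⟩ := p
          simp only [edgeCount] at hd hp
          revert a d t u
          simp only [Fin.forall_fin_two]
          simp [crossWeight]
          grind
        rw [this, zero_mul]

theorem fixedVector_eq_zero_of_odd (q : ℂ) (ys : List ℂ) (h : List (Fin 2))
    (hh : edgeCount h % 2 = 1) : fixedVector q ys h = 0 := by
  induction ys generalizing h with
  | nil =>
    rcases h with _ | ⟨a, h⟩
    · simp [edgeCount] at hh
    · simp [fixedVector]
  | cons y ys ih =>
    rcases h with _ | ⟨a, h⟩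
    · rfl
    · exact transport_eq_zero_of_parity q y ys 0 _ (fun h hh => ih h hh) a h
        (by simp only [edgeCount] at hh; omega)

end SpinHallLittlewood

end

/-! ### Row weights, and the passage from rows to columns. -/

noncomputable section

namespace SpinHallLittlewood

open Finset

section Shift

variable {α : Type*} [AddCommMonoid α]

/-- Removing the first entry of a finitely supported sequence. -/
def shiftTail (f : ℕ →₀ α) : ℕ →₀ α := f.comapDomain Nat.succ Nat.succ_injective.injOn

/-- Prepending an entry to a finitely supported sequence. -/
def shiftCons (a : α) (f : ℕ →₀ α) : ℕ →₀ α :=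
  Finsupp.single 0 a + f.embDomain ⟨Nat.succ, Nat.succ_injective⟩

@[simp] theorem shiftTail_apply (f : ℕ →₀ α) (i : ℕ) : shiftTail f i = f (i + 1) := rfl

@[simp] theorem shiftCons_zero (a : α) (f : ℕ →₀ α) : shiftCons a f 0 = a := by
  rw [shiftCons, Finsupp.add_apply, Finsupp.single_eq_same, Finsupp.embDomain_of_notMem_range, add_zero]
  simp

@[simp] theorem shiftCons_succ (a : α) (f : ℕ →₀ α) (i : ℕ) : shiftCons a f (i + 1) = f i := by
  rw [shiftCons, Finsupp.add_apply, Finsupp.single_eq_of_ne (by simp), zero_add]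
  exact Finsupp.embDomain_apply_self ⟨Nat.succ, Nat.succ_injective⟩ f i

@[simp] theorem shiftTail_shiftCons (a : α) (f : ℕ →₀ α) : shiftTail (shiftCons a f) = f := by
  ext i; simp

@[simp] theorem shiftCons_shiftTail (f : ℕ →₀ α) : shiftCons (f 0) (shiftTail f) = f := by
  ext i; cases i <;> simp

theorem shiftCons_zero_zero : shiftCons (0 : α) 0 = 0 := by
  ext i; cases i <;> simp

/-- Splitting off the first entry of a finitely supported sequence. -/
def shiftEquiv (α : Type*) [AddCommMonoid α] : α × (ℕ →₀ α) ≃ (ℕ →₀ α) where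
  toFun p := shiftCons p.1 p.2
  invFun f := (f 0, shiftTail f)
  left_inv p := by simp
  right_inv f := by simp

@[simp] theorem shiftTail_zero : shiftTail (0 : ℕ →₀ α) = 0 := by
  ext i; simp

theorem exists_bound (f : ℕ →₀ α) : ∃ N, ∀ i, N ≤ i → f i = 0 := by
  refine ⟨f.support.sup id + 1, fun i hi => ?_⟩
  by_contra h
  have : i ≤ f.support.sup id := Finset.le_sup (f := id) (Finsupp.mem_support_iff.2 h)
  omega

end Shift

/-- The weight of one configuration of the horizontal edges of a row. -/
def pathWeight (q s x : ℂ) (I K : Occupation) (h : ℕ →₀ Fin 2) : ℂ :=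
  ∏ᶠ i : ℕ, vertexWeight q s x (I i) (h (i + 1)) (K i) (h i)

variable {q s x : ℂ}

theorem vertexWeight_empty (hx : s * x ≠ 1) : vertexWeight q s x 0 0 0 0 = 1 := by
  have : 1 - s * x ≠ 0 := sub_ne_zero.2 hx.symm
  simp [vertexWeight, this]

theorem pathWeight_eq_prod (hx : s * x ≠ 1) {I K : Occupation} {h : ℕ →₀ Fin 2} {N : ℕ}
    (hI : ∀ i, N ≤ i → I i = 0) (hK : ∀ i, N ≤ i → K i = 0) (hh : ∀ i, N ≤ i → h i = 0) :
    pathWeight q s x I K h =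
      ∏ i ∈ range N, vertexWeight q s x (I i) (h (i + 1)) (K i) (h i) := by
  refine finprod_eq_prod_of_mulSupport_subset _ fun i hi => ?_
  by_contra hN
  have hN : N ≤ i := by simpa using hN
  refine hi ?_
  simp only [hI i hN, hK i hN, hh i hN, hh (i + 1) (by omega), vertexWeight_empty hx]

theorem exists_common_bound (I K : Occupation) (h : ℕ →₀ Fin 2) :
    ∃ N, (∀ i, N ≤ i → I i = 0) ∧ (∀ i, N ≤ i → K i = 0) ∧ ∀ i, N ≤ i → h i = 0 := by
  obtain ⟨a, ha⟩ := exists_bound I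
  obtain ⟨b, hb⟩ := exists_bound K
  obtain ⟨c, hc⟩ := exists_bound h
  exact ⟨a + b + c, fun i hi => ha i (by omega), fun i hi => hb i (by omega),
    fun i hi => hc i (by omega)⟩

theorem pathWeight_shiftCons (hx : s * x ≠ 1) (I K : Occupation) (l : Fin 2) (h : ℕ →₀ Fin 2) :
    pathWeight q s x I K (shiftCons l h) =
      vertexWeight q s x (I 0) (h 0) (K 0) l * pathWeight q s x (shiftTail I) (shiftTail K) h := by
  obtain ⟨N, hI, hK, hh⟩ := exists_common_bound I K h
  rw [pathWeight_eq_prod hx (N := N + 1) (fun i hi => hI i (by omega)) (fun i hi => hK i (by omega))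
      (fun i hi => ?_), pathWeight_eq_prod (I := shiftTail I) (K := shiftTail K) hx (N := N)
      (fun i hi => hI _ (by omega)) (fun i hi => hK _ (by omega)) hh, prod_range_succ']
  · simp [mul_comm]
  · obtain ⟨i, rfl⟩ : ∃ k, i = k + 1 := ⟨i - 1, by omega⟩
    rw [shiftCons_succ]
    exact hh i (by omega)

theorem vertexWeight_ne_zero_of_pathWeight (hx : s * x ≠ 1) {I K : Occupation} {h : ℕ →₀ Fin 2}
    (hW : pathWeight q s x I K h ≠ 0) (i : ℕ) :
    vertexWeight q s x (I i) (h (i + 1)) (K i) (h i) ≠ 0 := by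
  obtain ⟨N, hI, hK, hh⟩ := exists_common_bound I K h
  rw [pathWeight_eq_prod hx hI hK hh, prod_ne_zero_iff] at hW
  by_cases hi : i < N
  · exact hW i (by simpa using hi)
  · have hN : N ≤ i := by omega
    simp only [hI i hN, hK i hN, hh i hN, hh (i + 1) (by omega), vertexWeight_empty hx]
    exact one_ne_zero

theorem eq_zero_of_vertexWeight_ne_zero {K : ℕ} {l : Fin 2}
    (h : vertexWeight q s x 0 0 K l ≠ 0) : K = 0 ∧ l = 0 := by
  unfold vertexWeight at h
  split_ifs at h <;> simp_all

theorem top_le_of_vertexWeight_ne_zero {I K : ℕ} {j l : Fin 2}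
    (h : vertexWeight q s x I j K l ≠ 0) : K ≤ I + 1 := by
  unfold vertexWeight at h
  split_ifs at h <;> first | omega | exact absurd rfl h

/-- No path enters from the left end, so nothing can appear to the left of the last occupied bottom
edge. The induction starts where `h` vanishes and moves to the right. -/
theorem eq_zero_of_pathWeight_ne_zero (hx : s * x ≠ 1) {I K : Occupation} {h : ℕ →₀ Fin 2}
    (hW : pathWeight q s x I K h ≠ 0) {N : ℕ} (hI : ∀ i, N ≤ i → I i = 0) (i : ℕ) (hi : N ≤ i) :
    K i = 0 ∧ h i = 0 := by
  obtain ⟨M, hM⟩ := exists_bound h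
  have key : ∀ k i, N ≤ i → M ≤ i + k → h i = 0 := by
    intro k
    induction k with
    | zero => intro i _ hi; exact hM i hi
    | succ k ih =>
      intro i hi hk
      have := vertexWeight_ne_zero_of_pathWeight hx hW i
      rw [hI i hi, ih (i + 1) (by omega) (by omega)] at this
      exact (eq_zero_of_vertexWeight_ne_zero this).2
  have := vertexWeight_ne_zero_of_pathWeight hx hW i
  rw [hI i hi, key M (i + 1) (by omega) (by omega)] at this
  exact eq_zero_of_vertexWeight_ne_zero this

theorem finite_pathWeight_ne_zero (hx : s * x ≠ 1) (I K : Occupation) :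
    {h | pathWeight q s x I K h ≠ 0}.Finite := by
  obtain ⟨N, hI⟩ := exists_bound I
  refine Set.Finite.of_finite_image (f := fun h (i : Fin N) => h i) (Set.toFinite _) ?_
  intro h hh h' hh' he
  ext i : 1
  by_cases hi : i < N
  · exact congrFun he ⟨i, hi⟩
  · rw [(eq_zero_of_pathWeight_ne_zero hx hh hI i (by omega)).2,
      (eq_zero_of_pathWeight_ne_zero hx hh' hI i (by omega)).2]

theorem rowWeight_eq_finsum (l : Fin 2) (I K : Occupation) :
    rowWeight q s x l I K = ∑ᶠ h : ℕ →₀ Fin 2, pathWeight q s x I K (shiftCons l h) := by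
  let e : (ℕ →₀ Fin 2) ≃ {h : ℕ →₀ Fin 2 // h 0 = l} :=
    { toFun := fun h => ⟨shiftCons l h, by simp⟩
      invFun := fun h => shiftTail h.1
      left_inv := fun h => by simp
      right_inv := by rintro ⟨h, rfl⟩; simp }
  exact (finsum_comp_equiv e).symm

/-- The rightmost column is cut off and the configurations of the rest are sorted by the edge `a` at
the cut. -/
theorem rowWeight_eq_sum (hx : s * x ≠ 1) (l : Fin 2) (I K : Occupation) :
    rowWeight q s x l I K = ∑ a, vertexWeight q s x (I 0) a (K 0) l *
      rowWeight q s x a (shiftTail I) (shiftTail K) := by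
  have hfin := finite_pathWeight_ne_zero (q := q) hx (shiftTail I) (shiftTail K)
  rw [rowWeight_eq_finsum]
  simp only [pathWeight_shiftCons hx]
  rw [finsum_eq_sum_of_support_subset (s := hfin.toFinset) _ fun h hh => by
    simpa using right_ne_zero_of_mul hh]
  have hr : ∀ a, rowWeight q s x a (shiftTail I) (shiftTail K) =
      ∑ h ∈ hfin.toFinset, if h 0 = a then
        pathWeight q s x (shiftTail I) (shiftTail K) h else 0 := by
    intro a
    refine (finsum_subtype_eq_finsum_cond (f := pathWeight q s x (shiftTail I) (shiftTail K))
      (fun h : ℕ →₀ Fin 2 => h 0 = a)).trans ?_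
    simp only [finsum_eq_if]
    refine finsum_eq_sum_of_support_subset _ fun h hh => ?_
    have : pathWeight q s x (shiftTail I) (shiftTail K) h ≠ 0 := fun h0 => hh (by simp [h0])
    simpa using this
  simp only [hr, mul_sum]
  rw [sum_comm]
  refine sum_congr rfl fun h _ => ?_
  simp

theorem finite_rowWeight_ne_zero (hx : s * x ≠ 1) (I : Occupation) :
    {K | ∃ l, rowWeight q s x l I K ≠ 0}.Finite := by
  obtain ⟨N, hI⟩ := exists_bound I
  refine (Set.finite_Iic (∑ i ∈ range N, Finsupp.single i (I i + 1) : Occupation)).subset ?_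
  rintro K ⟨l, hK⟩
  obtain ⟨h, hh⟩ : ∃ h, pathWeight q s x I K (shiftCons l h) ≠ 0 := by
    by_contra hc
    push Not at hc
    exact hK (by rw [rowWeight_eq_finsum]; simp [hc])
  rw [Set.mem_Iic, Finsupp.le_def]
  intro i
  rw [Finsupp.finsetSum_apply]
  by_cases hi : i < N
  · simp only [Finsupp.single_apply, sum_ite_eq', mem_range, hi, if_true]
    exact top_le_of_vertexWeight_ne_zero (vertexWeight_ne_zero_of_pathWeight hx hh i)
  · rw [(eq_zero_of_pathWeight_ne_zero hx hh hI i (by omega)).1]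
    exact Nat.zero_le _

theorem rowWeight_zero (hx : s * x ≠ 1) (l : Fin 2) (K : Occupation) :
    rowWeight q s x l 0 K = if l = 0 ∧ K = 0 then 1 else 0 := by
  have hz : ∀ h, pathWeight q s x 0 K h ≠ 0 → K = 0 ∧ h = 0 := by
    intro h hh
    have := fun i => eq_zero_of_pathWeight_ne_zero hx hh (N := 0) (fun i _ => rfl) i (Nat.zero_le i)
    exact ⟨Finsupp.ext fun i => (this i).1, Finsupp.ext fun i => (this i).2⟩
  rw [rowWeight_eq_finsum]
  split_ifs with hl
  · obtain ⟨rfl, rfl⟩ := hl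
    rw [finsum_eq_single _ 0]
    · rw [shiftCons_zero_zero, pathWeight_eq_prod hx (N := 0) (fun _ _ => rfl) (fun _ _ => rfl)
        (fun _ _ => rfl), prod_range_zero]
    · intro h hne
      by_contra hc
      have := (hz _ hc).2
      exact hne (by rw [← shiftTail_shiftCons 0 h, this, shiftTail_zero])
  · refine finsum_eq_zero_of_forall_eq_zero fun h => ?_
    by_contra hc
    refine hl ⟨?_, (hz _ hc).1⟩
    rw [← shiftCons_zero l h, (hz _ hc).2]
    rfl

/-- The partition function of the rows `ys` (bottom row first) with bottom edges `I`, empty top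
edges and right edges `h`. -/
def rowsWeight (q s : ℂ) : List ℂ → List (Fin 2) → Occupation → ℂ
  | [], _ => fun I => if I = 0 then 1 else 0
  | _ :: _, [] => fun _ => 0
  | z :: ys, a :: h => fun I => ∑ᶠ K : Occupation, rowWeight q s z a I K * rowsWeight q s ys h K

theorem finsum_rowWeight_mul (I : Occupation) {S : Finset Occupation}
    (hS : {K | ∃ l, rowWeight q s x l I K ≠ 0} ⊆ S) (l : Fin 2) (g : Occupation → ℂ) :
    ∑ᶠ K, rowWeight q s x l I K * g K = ∑ K ∈ S, rowWeight q s x l I K * g K :=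
  finsum_eq_sum_of_support_subset _ fun _ hK => hS ⟨l, left_ne_zero_of_mul hK⟩

/-- This exchanges row and column transfer matrices: the rightmost column is split off from all rows
at once. -/
theorem rowsWeight_eq_column (ys : List ℂ) (hys : ∀ y ∈ ys, s * y ≠ 1) (h : List (Fin 2))
    (I : Occupation) : rowsWeight q s ys h I =
      column q s ys (fun h => rowsWeight q s ys h (shiftTail I)) h (I 0) := by
  induction ys generalizing h I with
  | nil =>
    have : I = 0 ↔ I 0 = 0 ∧ shiftTail I = 0 := by
      refine ⟨?_, fun hI => ?_⟩
      · rintro rfl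
        exact ⟨rfl, shiftTail_zero⟩
      · rw [← shiftCons_shiftTail I, hI.1, hI.2, shiftCons_zero_zero]
    simp only [rowsWeight, column, this]
    split_ifs <;> tauto
  | cons z ys ih =>
    rcases h with _ | ⟨a', h'⟩
    · rfl
    · have hz := hys z (by simp)
      obtain ⟨S, hS⟩ := (finite_rowWeight_ne_zero (q := q) hz (shiftTail I)).exists_finset_coe
      have hS' := hS.ge
      simp only [rowsWeight, column]
      rw [← finsum_comp_equiv (shiftEquiv ℕ)]
      have e1 : ∀ p : ℕ × Occupation, rowWeight q s z a' I (shiftEquiv ℕ p) *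
          rowsWeight q s ys h' (shiftEquiv ℕ p) = ∑ a, vertexWeight q s z (I 0) a p.1 a' *
            (rowWeight q s z a (shiftTail I) p.2 *
              column q s ys (fun h => rowsWeight q s ys h p.2) h' p.1) := by
        intro p
        rw [rowWeight_eq_sum hz, ih fun y hy => hys y (by simp [hy])]
        simp only [shiftEquiv, Equiv.coe_fn_mk, shiftCons_zero, shiftTail_shiftCons, sum_mul, mul_assoc]
      simp only [e1]
      rw [finsum_eq_sum_of_support_subset (s := range (I 0 + 2) ×ˢ S), sum_comm]
      · refine sum_congr rfl fun a _ => ?_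
        simp only [finsum_rowWeight_mul _ hS', column_sum, vertexOp, sum_product, mul_sum]
      · intro p hp
        obtain ⟨a, -, ha⟩ := exists_ne_zero_of_sum_ne_zero hp
        have h1 := top_le_of_vertexWeight_ne_zero (left_ne_zero_of_mul ha)
        have h2 : p.2 ∈ S := hS' ⟨a, left_ne_zero_of_mul (right_ne_zero_of_mul ha)⟩
        rw [mem_coe, mem_product, mem_range]
        exact ⟨by omega, h2⟩

theorem rowsWeight_zero (ys : List ℂ) (hys : ∀ y ∈ ys, s * y ≠ 1) (h : List (Fin 2))
    (hl : h.length = ys.length) :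
    rowsWeight q s ys h 0 = if h = List.replicate ys.length 0 then 1 else 0 := by
  induction ys generalizing h with
  | nil => simpa [rowsWeight] using hl
  | cons z ys ih =>
    rcases h with _ | ⟨a, h⟩
    · simp at hl
    · simp only [rowsWeight, rowWeight_zero (hys z (by simp))]
      rw [finsum_eq_single _ 0 (by simp +contextual),
        ih (fun y hy => hys y (by simp [hy])) h (by simpa using hl)]
      simp only [List.length_cons, List.replicate_succ, List.cons.injEq, and_true]
      split_ifs <;> simp_all

/-- Adding the two row operators amounts to leaving the right edge of each row free. -/
theorem foldr_rowOperator (ys : List ℂ) (hys : ∀ y ∈ ys, s * y ≠ 1) (I : Occupation) :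
    ys.foldr (fun y v => rowOperator q s y v) (Pi.single 0 1) I =
      total ys.length fun h => rowsWeight q s ys h I := by
  induction ys generalizing I with
  | nil => simp [total, rowsWeight, Pi.single_apply]
  | cons z ys ih =>
    have hz := hys z (by simp)
    obtain ⟨S, hS⟩ := (finite_rowWeight_ne_zero (q := q) hz I).exists_finset_coe
    have hS' := hS.ge
    rw [List.foldr_cons, rowOperator]
    simp only [ih fun y hy => hys y (by simp [hy]), List.length_cons, total, rowsWeight,
      finsum_rowWeight_mul _ hS', total_sum, Fin.sum_univ_two, ← sum_add_distrib, ← add_mul]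
    refine finsum_eq_sum_of_support_subset _ fun K hK => ?_
    by_contra hc
    have h0 : ∀ l, rowWeight q s z l I K = 0 := fun l => by
      by_contra h
      exact hc (hS' ⟨l, h⟩)
    exact hK (by simp [h0])

/-- The coefficient of the even boundary vector. -/
def occupationCoeff (q s : ℂ) (I : Occupation) : ℂ := I.prod fun _ m => evenCoeff q s (m / 2)

theorem occupationCoeff_shiftCons (m : ℕ) (I : Occupation) :
    occupationCoeff q s (shiftCons m I) = evenCoeff q s (m / 2) * occupationCoeff q s I := by
  rw [occupationCoeff, shiftCons, Finsupp.prod_add_index_of_disjoint,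
    Finsupp.prod_single_index (by simp [evenCoeff_zero]), Finsupp.prod_embDomain]
  · rfl
  · rw [Finsupp.support_embDomain]
    refine disjoint_of_subset_left Finsupp.support_single_subset ?_
    simp

/-- Prepending an even entry to an occupation. -/
def evenShift : ℕ × Occupation ↪ Occupation where
  toFun p := shiftCons (2 * p.1) p.2
  inj' p p' h := by
    have h1 := DFunLike.congr_fun h 0
    have h2 := congrArg shiftTail h
    simp only [shiftCons_zero, shiftTail_shiftCons] at h1 h2
    exact Prod.ext (by omega) h2

theorem evenShift_apply (p : ℕ × Occupation) : evenShift p = shiftCons (2 * p.1) p.2 := rfl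

/-- The even occupations of the first `N` columns with at most `2 * M` paths in each column. -/
def evenOccupations (M : ℕ) : ℕ → Finset Occupation
  | 0 => {0}
  | N + 1 => (range (M + 1) ×ˢ evenOccupations M N).map evenShift

theorem mem_evenOccupations {M N : ℕ} {I : Occupation} : I ∈ evenOccupations M N ↔
    (∀ i, Even (I i) ∧ I i ≤ 2 * M) ∧ ∀ i, N ≤ i → I i = 0 := by
  induction N generalizing I with
  | zero =>
    simp only [evenOccupations, mem_singleton]
    refine ⟨?_, fun h => Finsupp.ext fun i => h.2 i (Nat.zero_le i)⟩
    rintro rfl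
    simp
  | succ N ih =>
    simp only [evenOccupations, mem_map, mem_product, mem_range, evenShift_apply,
      Prod.exists, ih]
    constructor
    · rintro ⟨k, J, ⟨hk, hJ, hJ'⟩, rfl⟩
      refine ⟨?_, ?_⟩
      · rintro (_ | i)
        · simp only [shiftCons_zero]
          exact ⟨even_two_mul k, by omega⟩
        · simpa using hJ i
      · rintro (_ | i) hi
        · omega
        · simpa using hJ' i (by omega)
    · rintro ⟨h1, h2⟩
      obtain ⟨k, hk⟩ := (h1 0).1
      refine ⟨k, shiftTail I, ⟨?_, fun i => h1 (i + 1), fun i hi => h2 (i + 1) (by omega)⟩, ?_⟩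
      · have := (h1 0).2
        omega
      · rw [← two_mul] at hk
        rw [← hk, shiftCons_shiftTail]

/-- The partial sums of the Littlewood sum over the partitions with at most `N` columns. -/
def partialSum (q s : ℂ) (M : ℕ) (ys : List ℂ) (N : ℕ) (h : List (Fin 2)) : ℂ :=
  ∑ I ∈ evenOccupations M N, occupationCoeff q s I * rowsWeight q s ys h I

theorem partialSum_succ (M : ℕ) (ys : List ℂ) (hys : ∀ y ∈ ys, s * y ≠ 1) (N : ℕ)
    (h : List (Fin 2)) :
    partialSum q s M ys (N + 1) h = evenColumn q s M ys (partialSum q s M ys N) h := by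
  rw [partialSum, evenOccupations, sum_map, sum_product]
  refine sum_congr rfl fun k _ => ?_
  unfold partialSum
  rw [column_sum, mul_sum]
  refine sum_congr rfl fun I _ => ?_
  rw [evenShift_apply, rowsWeight_eq_column ys hys, occupationCoeff_shiftCons]
  simp [mul_assoc]

theorem partialSum_zero (M : ℕ) (ys : List ℂ) (hys : ∀ y ∈ ys, s * y ≠ 1) (h : List (Fin 2))
    (hl : h.length = ys.length) :
    partialSum q s M ys 0 h = if h = List.replicate ys.length 0 then 1 else 0 := by
  rw [partialSum, evenOccupations, sum_singleton, rowsWeight_zero ys hys h hl]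
  simp [occupationCoeff]

theorem rowsWeight_eq_zero (ys : List ℂ) (hys : ∀ y ∈ ys, s * y ≠ 1) (h : List (Fin 2))
    (I : Occupation) (i : ℕ) (hi : ys.length < I i) : rowsWeight q s ys h I = 0 := by
  induction i generalizing h I with
  | zero => rw [rowsWeight_eq_column ys hys, column_eq_zero_of_length_lt q s ys _ _ _ hi]
  | succ i ih =>
    rw [rowsWeight_eq_column ys hys]
    -- The zero vector is written as an empty linear combination, so that linearity of `column`
    -- applies.
    have : (fun h => rowsWeight q s ys h (shiftTail I)) = fun h =>
        ∑ i ∈ (∅ : Finset ℕ), (0 : ℂ) * (fun _ _ => 0 : ℕ → List (Fin 2) → ℂ) i h := by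
      funext h
      rw [ih h (shiftTail I) hi, sum_empty]
    rw [this, column_sum, sum_empty]

end SpinHallLittlewood

end

/-! ### Triangularity of the column operator and convergence. -/

noncomputable section

namespace SpinHallLittlewood

open Finset Filter Topology

theorem bounded_of_le_mul_add {a : ℕ → ℝ} {ρ C : ℝ} (hρ0 : 0 ≤ ρ) (hρ : ρ < 1)
    (h : ∀ N, a (N + 1) ≤ ρ * a N + C) : ∃ B, ∀ N, a N ≤ B := by
  -- `C / (1 - ρ)` is the fixed point of `t ↦ ρ t + C`, which preserves every upper bound above it.
  refine ⟨max (a 0) (C / (1 - ρ)), fun N => ?_⟩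
  induction N with
  | zero => exact le_max_left _ _
  | succ N ih =>
    have h1 : C / (1 - ρ) ≤ max (a 0) (C / (1 - ρ)) := le_max_right _ _
    rw [div_le_iff₀ (by linarith)] at h1
    nlinarith [h N, mul_le_mul_of_nonneg_left ih hρ0]

theorem tendsto_zero_of_le_mul_add {a e : ℕ → ℝ} {ρ : ℝ} (ha : ∀ N, 0 ≤ a N) (hρ0 : 0 ≤ ρ)
    (hρ : ρ < 1) (he : Tendsto e atTop (𝓝 0)) (h : ∀ N, a (N + 1) ≤ ρ * a N + e N) :
    Tendsto a atTop (𝓝 0) := by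
  rw [Metric.tendsto_atTop]
  intro ε hε
  -- An inhomogeneity of this size has fixed point `ε / 2`; the other half of `ε` absorbs the
  -- geometric term.
  have hpos : 0 < ε / 2 * (1 - ρ) := mul_pos (by linarith) (by linarith)
  obtain ⟨N₀, hN₀⟩ := eventually_atTop.1 (he.eventually (gt_mem_nhds hpos))
  have key : ∀ k, a (N₀ + k) ≤ ρ ^ k * a N₀ + ε / 2 := by
    intro k
    induction k with
    | zero => simp; linarith
    | succ k ih =>
      have h1 := h (N₀ + k)
      have h2 := hN₀ (N₀ + k) (by omega)
      rw [← add_assoc, pow_succ]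
      nlinarith [mul_le_mul_of_nonneg_left ih hρ0]
  have hlim : Tendsto (fun k => ρ ^ k * a N₀) atTop (𝓝 0) := by
    simpa using (tendsto_pow_atTop_nhds_zero_of_lt_one hρ0 hρ).mul_const (a N₀)
  obtain ⟨k₀, hk₀⟩ := eventually_atTop.1 (hlim.eventually (gt_mem_nhds (half_pos hε)))
  refine ⟨N₀ + k₀, fun N hN => ?_⟩
  obtain ⟨k, rfl⟩ : ∃ k, N = N₀ + k := ⟨N - N₀, by omega⟩
  rw [Real.dist_eq, sub_zero, abs_of_nonneg (ha _)]
  linarith [key k, hk₀ k (by omega)]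

section Triangular

variable {ι : Type*} {S : Finset ι} {g : ι → ι → ℝ} {rank : ι → ℕ} {p : ℕ → ι → ℝ}

theorem triangular_step [DecidableEq ι] (hrec : ∀ N, ∀ i ∈ S, p (N + 1) i ≤ ∑ j ∈ S, g i j * p N j)
    (htri : ∀ i ∈ S, ∀ j ∈ S, g i j ≠ 0 → rank j < rank i ∨ j = i) {i : ι} (hi : i ∈ S) (N : ℕ) :
    p (N + 1) i ≤ g i i * p N i + ∑ j ∈ S with rank j < rank i, g i j * p N j := by
  refine (hrec N i hi).trans_eq ?_
  rw [← add_sum_erase S _ hi, sum_filter]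
  congr 1
  rw [← add_sum_erase S (fun j => if rank j < rank i then g i j * p N j else 0) hi]
  simp only [lt_irrefl, if_false, zero_add]
  refine sum_congr rfl fun j hj => ?_
  rw [mem_erase] at hj
  split_ifs with hr
  · rfl
  · by_contra hc
    rcases htri i hi j hj.2 (left_ne_zero_of_mul hc) with h | h
    · exact hr h
    · exact hj.1 h

/-- By induction on the rank, the terms below the diagonal form a bounded inhomogeneity. The first
alternative in `hdiag` is for indices whose diagonal entry need not be less than 1. -/
theorem bounded_of_triangular (hg : ∀ i j, 0 ≤ g i j)
    (hrec : ∀ N, ∀ i ∈ S, p (N + 1) i ≤ ∑ j ∈ S, g i j * p N j)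
    (htri : ∀ i ∈ S, ∀ j ∈ S, g i j ≠ 0 → rank j < rank i ∨ j = i)
    (hdiag : ∀ i ∈ S, (∃ B, ∀ N, p N i ≤ B) ∨ g i i < 1) (i : ι) (hi : i ∈ S) :
    ∃ B, ∀ N, p N i ≤ B := by
  classical
  induction hm : rank i using Nat.strong_induction_on generalizing i with
  | _ m ih =>
    subst hm
    rcases hdiag i hi with h | h
    · exact h
    · have hB : ∀ j, ∃ B, j ∈ S → rank j < rank i → ∀ N, p N j ≤ B := by
        intro j
        by_cases hj : j ∈ S ∧ rank j < rank i
        · obtain ⟨B, hB⟩ := ih _ hj.2 j hj.1 rfl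
          exact ⟨B, fun _ _ => hB⟩
        · exact ⟨0, fun h1 h2 => absurd ⟨h1, h2⟩ hj⟩
      choose B hB using hB
      refine bounded_of_le_mul_add (hg i i) h (C := ∑ j ∈ S with rank j < rank i, g i j * B j)
        fun N => (triangular_step hrec htri hi N).trans ?_
      gcongr with j hj
      · exact hg i j
      · rw [mem_filter] at hj
        exact hB j hj.1 hj.2 N

theorem tendsto_zero_of_triangular (hg : ∀ i j, 0 ≤ g i j) (hp : ∀ N i, 0 ≤ p N i)
    (hrec : ∀ N, ∀ i ∈ S, p (N + 1) i ≤ ∑ j ∈ S, g i j * p N j)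
    (htri : ∀ i ∈ S, ∀ j ∈ S, g i j ≠ 0 → rank j < rank i ∨ j = i)
    (hdiag : ∀ i ∈ S, (∀ N, p N i = 0) ∨ g i i < 1) (i : ι) (hi : i ∈ S) :
    Tendsto (fun N => p N i) atTop (𝓝 0) := by
  classical
  induction hm : rank i using Nat.strong_induction_on generalizing i with
  | _ m ih =>
    subst hm
    rcases hdiag i hi with h | h
    · simp only [h]
      exact tendsto_const_nhds
    · refine tendsto_zero_of_le_mul_add (fun N => hp N i) (hg i i) h ?_
        (triangular_step hrec htri hi)
      rw [← sum_const_zero (s := S.filter fun j => rank j < rank i)]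
      refine tendsto_finsetSum _ fun j hj => ?_
      rw [mem_filter] at hj
      simpa using (ih _ hj.2 j hj.1 rfl).const_mul (g i j)

end Triangular

/-- The states of the horizontal edges of `n` rows. -/
def edgeStates (n : ℕ) : Finset (List (Fin 2)) := (List.finite_length_eq (Fin 2) n).toFinset

@[simp] theorem mem_edgeStates {n : ℕ} {h : List (Fin 2)} : h ∈ edgeStates n ↔ h.length = n := by
  simp [edgeStates]

/-- The sum of the numbers of occupied edges over all suffixes. -/
def suffixSum : List (Fin 2) → ℕ
  | [] => 0
  | a :: h => edgeCount (a :: h) + suffixSum h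

/-- The matrix entries of `column`. -/
def columnEntry (q s : ℂ) (ys : List ℂ) (h' h : List (Fin 2)) (I : ℕ) : ℂ :=
  column q s ys (Pi.single h 1) h' I

variable {q s : ℂ}

theorem column_congr (ys : List ℂ) {v w : List (Fin 2) → ℂ}
    (hvw : ∀ h, h.length = ys.length → v h = w h) {h' : List (Fin 2)}
    (hl : h'.length = ys.length) (I : ℕ) : column q s ys v h' I = column q s ys w h' I := by
  induction ys generalizing v w h' I with
  | nil => simp only [column, hvw h' hl]
  | cons z ys ih =>
    rcases h' with _ | ⟨a', h'⟩
    · rfl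
    · simp only [column]
      refine sum_congr rfl fun a _ => congrArg (fun f => vertexOp q s z a a' f I) (funext fun K => ?_)
      exact ih (fun h hh => hvw _ (by simp [hh])) (by simpa using hl) K

theorem column_eq_sum_columnEntry (ys : List ℂ) (v : List (Fin 2) → ℂ) {h' : List (Fin 2)}
    (hl : h'.length = ys.length) (I : ℕ) : column q s ys v h' I =
      ∑ h ∈ edgeStates ys.length, v h * columnEntry q s ys h' h I := by
  unfold columnEntry
  rw [← column_sum]
  refine column_congr ys (fun h hh => ?_) hl I
  simp [Pi.single_apply, hh]

theorem columnEntry_cons (z : ℂ) (ys : List ℂ) (a' a : Fin 2) (h' h : List (Fin 2)) (I : ℕ) :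
    columnEntry q s (z :: ys) (a' :: h') (a :: h) I =
      vertexOp q s z a a' (columnEntry q s ys h' h) I := by
  simp only [columnEntry, column]
  rw [sum_eq_single a]
  · refine congrArg (fun f => vertexOp q s z a a' f I) (funext fun K => ?_)
    congr 1
    funext h₁
    simp [Pi.single_apply]
  · intro b _ hb
    refine sum_eq_zero fun K _ => ?_
    have : (fun h₁ => (Pi.single (a :: h) 1 : List (Fin 2) → ℂ) (b :: h₁)) =
        fun h => ∑ i ∈ (∅ : Finset ℕ), (0 : ℂ) * (fun _ _ => 0 : ℕ → List (Fin 2) → ℂ) i h := by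
      funext h₁
      simp [hb]
    rw [this, column_sum, sum_empty, mul_zero]
  · simp

theorem flux_of_vertexWeight_ne_zero {x : ℂ} {I K : ℕ} {j l : Fin 2}
    (h : vertexWeight q s x I j K l ≠ 0) : I + (j : ℕ) = K + (l : ℕ) := by
  unfold vertexWeight at h
  split_ifs at h <;> simp_all

/-- Path conservation holds for the whole column and for each block of top rows. The vertical flux
into such a block is non-negative, so every suffix count weakly increases from left to right; if all
are equal, the states coincide. -/
theorem suffixSum_of_columnEntry_ne_zero (ys : List ℂ) {h' h : List (Fin 2)} {I : ℕ}
    (hl' : h'.length = ys.length) (hl : h.length = ys.length)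
    (hne : columnEntry q s ys h' h I ≠ 0) :
    edgeCount h + I = edgeCount h' ∧ suffixSum h ≤ suffixSum h' ∧
      (suffixSum h = suffixSum h' → h = h') := by
  induction ys generalizing h' h I with
  | nil =>
    rw [List.length_nil, List.length_eq_zero_iff] at hl hl'
    subst hl hl'
    have hI : I = 0 := by
      by_contra hI
      exact hne (by simp [columnEntry, column, hI])
    simp [hI]
  | cons z ys ih =>
    rcases h' with _ | ⟨a', h'⟩
    · simp at hl'
    rcases h with _ | ⟨a, h⟩
    · simp at hl
    rw [columnEntry_cons] at hne
    obtain ⟨K, -, hK⟩ := exists_ne_zero_of_sum_ne_zero hne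
    have h1 := flux_of_vertexWeight_ne_zero (left_ne_zero_of_mul hK)
    obtain ⟨h2, h3, h4⟩ := ih (by simpa using hl') (by simpa using hl) (right_ne_zero_of_mul hK)
    simp only [edgeCount, suffixSum]
    refine ⟨by omega, by omega, fun he => ?_⟩
    have h5 : suffixSum h = suffixSum h' := by omega
    have h6 := h4 h5
    subst h6
    rw [Fin.ext (show (a : ℕ) = a' by omega)]

/-- The diagonal entries of the column with empty bottom edge. -/
def diagEntry (s : ℂ) : List ℂ → List (Fin 2) → ℂ
  | z :: ys, a :: h => (if a = 0 then 1 else (z - s) / (1 - s * z)) * diagEntry s ys h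
  | _, _ => 1

theorem columnEntry_self (ys : List ℂ) (hys : ∀ y ∈ ys, s * y ≠ 1) {h : List (Fin 2)}
    (hl : h.length = ys.length) : columnEntry q s ys h h 0 = diagEntry s ys h := by
  induction ys generalizing h with
  | nil => simp [columnEntry, column, diagEntry]
  | cons z ys ih =>
    rcases h with _ | ⟨a, h⟩
    · simp at hl
    have hz : 1 - s * z ≠ 0 := sub_ne_zero.2 (hys z (by simp)).symm
    rw [columnEntry_cons, diagEntry, ← ih (fun y hy => hys y (by simp [hy])) (by simpa using hl)]
    clear hl
    revert a
    simp only [Fin.forall_fin_two]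
    refine ⟨?_, ?_⟩
    · rw [vertexOp_zero_zero]
      simp [hz]
    · rw [vertexOp_one_one]
      simp

/-- A single factor may have modulus at least 1, so the occupied edges are paired in order. In the
odd case `u` stands for the factor of an earlier edge that still awaits its partner. -/
theorem norm_diagEntry_lt (ys : List ℂ)
    (hadm : ys.Pairwise fun y z => ‖(y - s) / (1 - s * y) * ((z - s) / (1 - s * z))‖ < 1)
    (h : List (Fin 2)) (hl : h.length = ys.length) :
    (edgeCount h % 2 = 0 → ‖diagEntry s ys h‖ ≤ 1 ∧ (edgeCount h ≠ 0 → ‖diagEntry s ys h‖ < 1)) ∧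
    (edgeCount h % 2 = 1 → ∀ u : ℂ, (∀ z ∈ ys, ‖u * ((z - s) / (1 - s * z))‖ < 1) →
      ‖u * diagEntry s ys h‖ < 1) := by
  induction ys generalizing h with
  | nil =>
    rw [List.length_nil, List.length_eq_zero_iff] at hl
    subst hl
    simp [edgeCount, diagEntry]
  | cons y ys ih =>
    rcases h with _ | ⟨a, h⟩
    · simp at hl
    rw [List.pairwise_cons] at hadm
    obtain ⟨h1, h2⟩ := ih hadm.2 h (by simpa using hl)
    clear hl
    revert a
    simp only [Fin.forall_fin_two]
    refine ⟨⟨?_, ?_⟩, ?_, ?_⟩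
    · simpa [edgeCount, diagEntry] using h1
    · simp only [edgeCount, diagEntry, Fin.val_zero, zero_add, if_true, one_mul]
      exact fun hh u hu => h2 hh u fun z hz => hu z (by simp [hz])
    · simp only [edgeCount, diagEntry, Fin.val_one, one_ne_zero, if_false]
      intro hh
      have := h2 (by omega) _ hadm.1
      exact ⟨this.le, fun _ => this⟩
    · simp only [edgeCount, diagEntry, Fin.val_one, one_ne_zero, if_false]
      intro hh u hu
      rw [← mul_assoc, norm_mul]
      have h3 := hu y (by simp)
      have h4 := (h1 (by omega)).1
      nlinarith [norm_nonneg (u * ((y - s) / (1 - s * y))), norm_nonneg (diagEntry s ys h)]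

/-- Bounds for the matrix entries of `evenColumn`. -/
def evenEntryBound (q s : ℂ) (M : ℕ) (ys : List ℂ) (h' h : List (Fin 2)) : ℝ :=
  ∑ k ∈ range (M + 1), ‖evenCoeff q s k * columnEntry q s ys h' h (2 * k)‖

theorem evenEntryBound_nonneg (M : ℕ) (ys : List ℂ) (h' h : List (Fin 2)) :
    0 ≤ evenEntryBound q s M ys h' h := sum_nonneg fun _ _ => norm_nonneg _

theorem suffixSum_of_evenEntryBound_ne_zero (M : ℕ) (ys : List ℂ) {h' h : List (Fin 2)}
    (hl' : h' ∈ edgeStates ys.length) (hl : h ∈ edgeStates ys.length)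
    (hne : evenEntryBound q s M ys h' h ≠ 0) :
    edgeCount h ≤ edgeCount h' ∧ edgeCount h % 2 = edgeCount h' % 2 ∧
      (suffixSum h < suffixSum h' ∨ h = h') := by
  obtain ⟨k, -, hk⟩ := exists_ne_zero_of_sum_ne_zero hne
  obtain ⟨h1, h2, h3⟩ := suffixSum_of_columnEntry_ne_zero ys (mem_edgeStates.1 hl')
    (mem_edgeStates.1 hl) (right_ne_zero_of_mul (norm_ne_zero_iff.1 hk))
  exact ⟨by omega, by omega, by
    rcases h2.lt_or_eq with h | h
    · exact Or.inl h
    · exact Or.inr (h3 h)⟩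

theorem evenEntryBound_self (M : ℕ) (ys : List ℂ) (hys : ∀ y ∈ ys, s * y ≠ 1)
    {h : List (Fin 2)} (hl : h ∈ edgeStates ys.length) :
    evenEntryBound q s M ys h h = ‖diagEntry s ys h‖ := by
  rw [mem_edgeStates] at hl
  rw [evenEntryBound, sum_eq_single 0]
  · rw [evenCoeff_zero, one_mul, mul_zero, columnEntry_self ys hys hl]
  · intro k _ hk
    by_contra hc
    have := (suffixSum_of_columnEntry_ne_zero ys hl hl
      (right_ne_zero_of_mul (norm_ne_zero_iff.1 hc))).1
    omega
  · simp

theorem eq_replicate_of_edgeCount_eq_zero {h : List (Fin 2)} (hh : edgeCount h = 0) :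
    h = List.replicate h.length 0 := by
  induction h with
  | nil => rfl
  | cons a h ih =>
    simp only [edgeCount, Nat.add_eq_zero_iff] at hh
    rw [List.length_cons, List.replicate_succ, ← ih hh.2, Fin.ext (show (a : ℕ) = (0 : Fin 2) from hh.1)]

theorem edgeCount_replicate (n : ℕ) : edgeCount (List.replicate n 0) = 0 := by
  induction n with
  | zero => rfl
  | succ n ih => simp [List.replicate_succ, edgeCount, ih]

section Recursion

variable {M : ℕ} {ys : List ℂ} {p : ℕ → List (Fin 2) → ℝ}

theorem eq_zero_of_odd_of_evenEntryBound (hp : ∀ N h, 0 ≤ p N h)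
    (hrec : ∀ N, ∀ h' ∈ edgeStates ys.length, p (N + 1) h' ≤
      ∑ h ∈ edgeStates ys.length, evenEntryBound q s M ys h' h * p N h)
    (hodd : ∀ h ∈ edgeStates ys.length, edgeCount h % 2 = 1 → p 0 h = 0) (N : ℕ) :
    ∀ h ∈ edgeStates ys.length, edgeCount h % 2 = 1 → p N h = 0 := by
  induction N with
  | zero => exact hodd
  | succ N ih =>
    intro h' hh' ho
    refine le_antisymm ((hrec N h' hh').trans_eq (sum_eq_zero fun h hh => ?_)) (hp _ _)
    by_contra hc
    have := (suffixSum_of_evenEntryBound_ne_zero M ys hh' hh (left_ne_zero_of_mul hc)).2.1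
    exact right_ne_zero_of_mul hc (ih h hh (by omega))

/-- With an empty state on the right, conservation forces an empty state on the left, so only the
diagonal term survives. -/
theorem le_of_edgeCount_eq_zero (hys : ∀ y ∈ ys, s * y ≠ 1)
    (hadm : ys.Pairwise fun y z => ‖(y - s) / (1 - s * y) * ((z - s) / (1 - s * z))‖ < 1)
    (hp : ∀ N h, 0 ≤ p N h)
    (hrec : ∀ N, ∀ h' ∈ edgeStates ys.length, p (N + 1) h' ≤
      ∑ h ∈ edgeStates ys.length, evenEntryBound q s M ys h' h * p N h)
    {h' : List (Fin 2)} (hh' : h' ∈ edgeStates ys.length) (h0 : edgeCount h' = 0) (N : ℕ) :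
    p N h' ≤ p 0 h' := by
  induction N with
  | zero => exact le_rfl
  | succ N ih =>
    refine le_trans ((hrec N h' hh').trans ?_) ih
    rw [sum_eq_single h']
    · rw [evenEntryBound_self M ys hys hh']
      have := ((norm_diagEntry_lt ys hadm h' (mem_edgeStates.1 hh')).1 (by omega)).1
      nlinarith [hp N h']
    · intro h hh hne
      by_contra hc
      have h1 := (suffixSum_of_evenEntryBound_ne_zero M ys hh' hh (left_ne_zero_of_mul hc)).1
      refine hne ?_
      rw [eq_replicate_of_edgeCount_eq_zero h0,
        eq_replicate_of_edgeCount_eq_zero (h := h) (by omega),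
        mem_edgeStates.1 hh, mem_edgeStates.1 hh']
    · exact fun h => absurd hh' h

theorem bounded_of_evenEntryBound (hys : ∀ y ∈ ys, s * y ≠ 1)
    (hadm : ys.Pairwise fun y z => ‖(y - s) / (1 - s * y) * ((z - s) / (1 - s * z))‖ < 1)
    (hp : ∀ N h, 0 ≤ p N h)
    (hrec : ∀ N, ∀ h' ∈ edgeStates ys.length, p (N + 1) h' ≤
      ∑ h ∈ edgeStates ys.length, evenEntryBound q s M ys h' h * p N h)
    (hodd : ∀ h ∈ edgeStates ys.length, edgeCount h % 2 = 1 → p 0 h = 0) :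
    ∀ h ∈ edgeStates ys.length, ∃ B, ∀ N, p N h ≤ B := by
  refine bounded_of_triangular (rank := suffixSum) (evenEntryBound_nonneg M ys) hrec
    (fun h' hh' h hh hne => (suffixSum_of_evenEntryBound_ne_zero M ys hh' hh hne).2.2)
    fun h hh => ?_
  by_cases h1 : edgeCount h % 2 = 1
  · exact Or.inl ⟨0, fun N => (eq_zero_of_odd_of_evenEntryBound hp hrec hodd N h hh h1).le⟩
  by_cases h0 : edgeCount h = 0
  · exact Or.inl ⟨p 0 h, le_of_edgeCount_eq_zero hys hadm hp hrec hh h0⟩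
  · right
    rw [evenEntryBound_self M ys hys hh]
    exact ((norm_diagEntry_lt ys hadm h (mem_edgeStates.1 hh)).1 (by omega)).2 h0

theorem tendsto_zero_of_evenEntryBound (hys : ∀ y ∈ ys, s * y ≠ 1)
    (hadm : ys.Pairwise fun y z => ‖(y - s) / (1 - s * y) * ((z - s) / (1 - s * z))‖ < 1)
    (hp : ∀ N h, 0 ≤ p N h)
    (hrec : ∀ N, ∀ h' ∈ edgeStates ys.length, p (N + 1) h' ≤
      ∑ h ∈ edgeStates ys.length, evenEntryBound q s M ys h' h * p N h)
    (hodd : ∀ h ∈ edgeStates ys.length, edgeCount h % 2 = 1 → p 0 h = 0)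
    (hzero : p 0 (List.replicate ys.length 0) = 0) :
    ∀ h ∈ edgeStates ys.length, Tendsto (fun N => p N h) atTop (𝓝 0) := by
  refine tendsto_zero_of_triangular (rank := suffixSum) (evenEntryBound_nonneg M ys) hp hrec
    (fun h' hh' h hh hne => (suffixSum_of_evenEntryBound_ne_zero M ys hh' hh hne).2.2)
    fun h hh => ?_
  by_cases h1 : edgeCount h % 2 = 1
  · exact Or.inl fun N => eq_zero_of_odd_of_evenEntryBound hp hrec hodd N h hh h1
  by_cases h0 : edgeCount h = 0
  · refine Or.inl fun N => le_antisymm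
      ((le_of_edgeCount_eq_zero hys hadm hp hrec hh h0 N).trans_eq ?_) (hp N h)
    rw [eq_replicate_of_edgeCount_eq_zero h0, mem_edgeStates.1 hh, hzero]
  · right
    rw [evenEntryBound_self M ys hys hh]
    exact ((norm_diagEntry_lt ys hadm h (mem_edgeStates.1 hh)).1 (by omega)).2 h0

end Recursion

variable {ys : List ℂ}

/-- The recursion of `partialSum_succ` survives, as an inequality, when every term is replaced by
its norm. -/
theorem bounded_sum_norm (M : ℕ) (hys : ∀ y ∈ ys, s * y ≠ 1)
    (hadm : ys.Pairwise fun y z => ‖(y - s) / (1 - s * y) * ((z - s) / (1 - s * z))‖ < 1) :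
    ∀ h ∈ edgeStates ys.length, ∃ B, ∀ N,
      ∑ I ∈ evenOccupations M N, ‖occupationCoeff q s I * rowsWeight q s ys h I‖ ≤ B := by
  refine bounded_of_evenEntryBound (M := M) (q := q) hys hadm
    (p := fun N h => ∑ I ∈ evenOccupations M N, ‖occupationCoeff q s I * rowsWeight q s ys h I‖)
    (fun N h => by positivity) (fun N h' hh' => ?_) fun h hh ho => ?_
  · simp only [evenEntryBound, sum_mul]
    simp only [mul_sum]
    rw [evenOccupations, sum_map, sum_product, sum_comm (s := edgeStates ys.length)]
    refine sum_le_sum fun k _ => ?_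
    rw [sum_comm]
    refine sum_le_sum fun I _ => ?_
    rw [evenShift_apply, rowsWeight_eq_column ys hys, occupationCoeff_shiftCons,
      column_eq_sum_columnEntry ys _ (mem_edgeStates.1 hh'), mul_sum]
    refine (norm_sum_le _ _).trans_eq (sum_congr rfl fun h _ => ?_)
    simp only [← norm_mul, shiftCons_zero, shiftTail_shiftCons]
    congr 1
    rw [Nat.mul_div_cancel_left k two_pos]
    ring
  · rw [evenOccupations, sum_singleton, rowsWeight_zero ys hys h (mem_edgeStates.1 hh), if_neg]
    · simp
    · rintro rfl
      rw [edgeCount_replicate] at ho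
      omega

/-- Since `fixedVector` is fixed, the error obeys the homogeneous recursion. It starts at 0 on odd
states by parity and on the empty state because both vectors equal 1 there. -/
theorem tendsto_partialSum (M : ℕ) (hb : ∀ k : ℕ, 1 ≤ k → s ^ 2 * q ^ (2 * k - 1) ≠ 1)
    (hys : ∀ y ∈ ys, s * y ≠ 1) (hM : ys.length ≤ 2 * M + 1)
    (hadm : ys.Pairwise fun y z => ‖(y - s) / (1 - s * y) * ((z - s) / (1 - s * z))‖ < 1)
    (hne : ys.Pairwise fun y z => z * y ≠ 1) :
    ∀ h ∈ edgeStates ys.length,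
      Tendsto (fun N => partialSum q s M ys N h) atTop (𝓝 (fixedVector q ys h)) := by
  intro h hh
  rw [tendsto_iff_norm_sub_tendsto_zero]
  revert h
  refine tendsto_zero_of_evenEntryBound (M := M) (q := q) hys hadm (fun N h => norm_nonneg _)
    (fun N h' hh' => ?_) (fun h hh ho => ?_) ?_
  · rw [partialSum_succ M ys hys, ← evenColumn_fixedVector hb M ys hys hM, evenColumn, evenColumn,
      ← sum_sub_distrib]
    simp only [evenEntryBound, sum_mul]
    rw [sum_comm]
    refine (norm_sum_le _ _).trans (sum_le_sum fun k _ => ?_)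
    rw [column_eq_sum_columnEntry ys _ (mem_edgeStates.1 hh'),
      column_eq_sum_columnEntry ys _ (mem_edgeStates.1 hh'), ← mul_sub, ← sum_sub_distrib, mul_sum]
    refine (norm_sum_le _ _).trans_eq (sum_congr rfl fun h _ => ?_)
    rw [← norm_mul]
    congr 1
    ring
  · rw [partialSum_zero M ys hys h (mem_edgeStates.1 hh), fixedVector_eq_zero_of_odd q ys h ho,
      if_neg, sub_zero, norm_zero]
    rintro rfl
    rw [edgeCount_replicate] at ho
    omega
  · rw [partialSum_zero M ys hys _ List.length_replicate, fixedVector_replicate q ys hne]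
    simp

theorem total_eq_sum (n : ℕ) (v : List (Fin 2) → ℂ) : total n v = ∑ h ∈ edgeStates n, v h := by
  induction n generalizing v with
  | zero =>
    have : edgeStates 0 = {[]} := by ext h; simp
    rw [this, sum_singleton, total]
  | succ n ih =>
    simp only [total, ih]
    rw [← sum_product']
    refine sum_bij (fun p _ => p.1 :: p.2) ?_ ?_ ?_ ?_
    · simp
    · rintro ⟨a, h⟩ _ ⟨a', h'⟩ _ he
      simpa using he
    · rintro (_ | ⟨a, h⟩) hh
      · simp at hh
      · exact ⟨(a, h), by simpa using hh, rfl⟩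
    · simp

/-- The Littlewood identity as a sum over even occupations. -/
theorem hasSum_even (hb : ∀ k : ℕ, 1 ≤ k → s ^ 2 * q ^ (2 * k - 1) ≠ 1)
    (hys : ∀ y ∈ ys, s * y ≠ 1)
    (hadm : ys.Pairwise fun y z => ‖(y - s) / (1 - s * y) * ((z - s) / (1 - s * z))‖ < 1)
    (hne : ys.Pairwise fun y z => z * y ≠ 1) :
    HasSum (fun I : {I : Occupation // ∀ i, Even (I i)} =>
      occupationCoeff q s I.1 * total ys.length fun h => rowsWeight q s ys h I.1)
      (pairProduct q ys) := by
  set M := ys.length with hM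
  let F : Occupation → ℂ := fun I =>
    occupationCoeff q s I * total ys.length fun h => rowsWeight q s ys h I
  -- A column holding more paths than there are rows contributes zero, so the bound loses nothing,
  -- and the finite sets `evenOccupations M N` exhaust `A`.
  let A : Set Occupation := {I | ∀ i, Even (I i) ∧ I i ≤ 2 * M}
  suffices HasSum (A.indicator F) (pairProduct q ys) by
    have hA : A.indicator F = {I : Occupation | ∀ i, Even (I i)}.indicator F := by
      funext I
      by_cases h1 : ∀ i, Even (I i)
      · rw [Set.indicator_of_mem (s := {I : Occupation | ∀ i, Even (I i)}) h1]
        by_cases h2 : ∀ i, I i ≤ 2 * M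
        · exact Set.indicator_of_mem (fun i => ⟨h1 i, h2 i⟩) F
        · push Not at h2
          obtain ⟨i, hi⟩ := h2
          rw [Set.indicator_of_notMem fun h => (h i).2.not_gt hi]
          simp only [F, total_eq_sum]
          rw [sum_eq_zero fun h _ => rowsWeight_eq_zero ys hys h I i (by omega), mul_zero]
      · rw [Set.indicator_of_notMem (s := {I : Occupation | ∀ i, Even (I i)}) h1,
          Set.indicator_of_notMem fun h => h1 fun i => (h i).1]
    rw [hA] at this
    exact hasSum_subtype_iff_indicator.2 this
  have hmem : ∀ N, ∀ I ∈ evenOccupations M N, A.indicator F I = F I := fun N I hI =>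
    Set.indicator_of_mem (s := A) (mem_evenOccupations.1 hI).1 F
  have hcover : ∀ T : Finset Occupation, ∃ N, ∀ I ∈ T, I ∈ A → I ∈ evenOccupations M N := by
    intro T
    choose b hb using fun I : Occupation => exists_bound I
    refine ⟨T.sup b, fun I hI hA => mem_evenOccupations.2 ⟨hA, fun i hi => hb I i ?_⟩⟩
    exact (Finset.le_sup hI).trans hi
  choose! B hB using bounded_sum_norm (q := q) M hys hadm
  have hsummable : Summable (A.indicator F) := by
    refine Summable.of_norm (summable_of_sum_le (c := ∑ h ∈ edgeStates ys.length, B h)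
      (fun I => norm_nonneg _) fun T => ?_)
    obtain ⟨N, hN⟩ := hcover T
    calc ∑ I ∈ T, ‖A.indicator F I‖ ≤ ∑ I ∈ T with I ∈ evenOccupations M N, ‖A.indicator F I‖ := by
          rw [sum_filter]
          refine sum_le_sum fun I hI => ?_
          split_ifs with h
          · exact le_rfl
          · rw [Set.indicator_of_notMem fun hA => h (hN I hI hA), norm_zero]
      _ ≤ ∑ I ∈ evenOccupations M N, ‖A.indicator F I‖ :=
          sum_le_sum_of_subset_of_nonneg (fun I hI => (mem_filter.1 hI).2)
            fun _ _ _ => norm_nonneg _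
      _ ≤ ∑ I ∈ evenOccupations M N, ∑ h ∈ edgeStates ys.length,
            ‖occupationCoeff q s I * rowsWeight q s ys h I‖ := by
          refine sum_le_sum fun I hI => ?_
          rw [hmem N I hI]
          simp only [F]
          rw [total_eq_sum, mul_sum]
          exact norm_sum_le _ _
      _ ≤ ∑ h ∈ edgeStates ys.length, B h := by
          rw [sum_comm]
          exact sum_le_sum fun h hh => hB h hh N
  classical
  have hT : Tendsto (fun N => (evenOccupations M N).subtype (· ∈ A)) atTop atTop := by
    refine tendsto_atTop_finset_of_monotone (fun N N' hN I hI => ?_) fun I => ?_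
    · rw [mem_subtype, mem_evenOccupations] at hI ⊢
      exact ⟨hI.1, fun i hi => hI.2 i (hN.trans hi)⟩
    · obtain ⟨N, hN⟩ := hcover {I.1}
      exact ⟨N, mem_subtype.2 (hN I.1 (mem_singleton_self _) I.2)⟩
  have hlim : Tendsto (fun N => ∑ h ∈ edgeStates ys.length, partialSum q s M ys N h) atTop
      (𝓝 (pairProduct q ys)) := by
    rw [← total_fixedVector q ys hne, total_eq_sum]
    exact tendsto_finsetSum _ (tendsto_partialSum M hb hys (by omega) hadm hne)
  have hsub := (hasSum_subtype_iff_indicator.2 hsummable.hasSum).comp hT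
  have heq : tsum (A.indicator F) = pairProduct q ys := by
    refine tendsto_nhds_unique hsub (hlim.congr fun N => ?_)
    simp only [Function.comp_apply, partialSum]
    rw [sum_subtype_of_mem (p := (· ∈ A)) F fun I hI => (mem_evenOccupations.1 hI).1, sum_comm]
    refine sum_congr rfl fun I _ => ?_
    simp only [F]
    rw [total_eq_sum, mul_sum]
  rw [← heq]
  exact hsummable.hasSum

end SpinHallLittlewood

end

/-! ### Partitions as occupations, and the translation of both sides. -/

noncomputable section

namespace SpinHallLittlewood

open Finset

theorem occupation_apply (lam : YoungDiagram) (i : ℕ) :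
    occupation lam i = lam.rowLens.count (i + 1) := rfl

theorem occupation_bot : occupation ⊥ = 0 := by
  ext i
  rw [occupation_apply, List.count_eq_zero_of_not_mem]
  · rfl
  · intro h
    rw [YoungDiagram.rowLens, List.mem_map] at h
    obtain ⟨k, hk, -⟩ := h
    rw [List.mem_range, ← YoungDiagram.mem_iff_lt_colLen] at hk
    exact YoungDiagram.notMem_bot _ hk

theorem countP_lt_range {c n : ℕ} (h : c ≤ n) : (List.range n).countP (fun i => i < c) = c := by
  obtain ⟨m, rfl⟩ := Nat.exists_eq_add_of_le h
  rw [List.range_add, List.countP_append, List.countP_eq_length.2 (by simp),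
    List.countP_eq_zero.2 (by simp)]
  simp

theorem colLen_eq_countP (lam : YoungDiagram) (j : ℕ) :
    lam.colLen j = lam.rowLens.countP (fun r => j < r) := by
  rw [YoungDiagram.rowLens, List.countP_map]
  simp only [Function.comp_def, ← YoungDiagram.mem_iff_lt_rowLen]
  simp only [YoungDiagram.mem_iff_lt_colLen]
  exact (countP_lt_range (lam.colLen_anti 0 j (Nat.zero_le j))).symm

theorem countP_lt_eq_count_add (l : List ℕ) (j : ℕ) :
    l.countP (fun r => j < r) = l.count (j + 1) + l.countP (fun r => j + 1 < r) := by
  induction l with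
  | nil => rfl
  | cons a l ih =>
    simp only [List.countP_cons, List.count_cons, ih, decide_eq_true_eq, beq_iff_eq]
    split_ifs <;> omega

theorem colLen_eq_occupation_add (lam : YoungDiagram) (j : ℕ) :
    lam.colLen j = occupation lam j + lam.colLen (j + 1) := by
  rw [colLen_eq_countP, colLen_eq_countP, countP_lt_eq_count_add]
  rfl

/-- Multiplicities are differences of consecutive column lengths. Conversely, column lengths are
recovered by summing from beyond the first row, where they vanish. -/
theorem isEvenPartition_transpose_iff (lam : YoungDiagram) :
    IsEvenPartition lam.transpose ↔ ∀ i, Even (occupation lam i) := by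
  simp only [IsEvenPartition, YoungDiagram.rowLen_transpose]
  refine ⟨fun h i => ?_, fun h => ?_⟩
  · have h1 := h i
    rw [colLen_eq_occupation_add, Nat.even_add] at h1
    exact h1.2 (h (i + 1))
  · have hz : ∀ j, lam.rowLen 0 ≤ j → lam.colLen j = 0 := by
      intro j hj
      by_contra hc
      have := YoungDiagram.mem_iff_lt_rowLen.1
        (YoungDiagram.mem_iff_lt_colLen.2 (Nat.pos_of_ne_zero hc))
      omega
    have key : ∀ k j, lam.rowLen 0 ≤ j + k → Even (lam.colLen j) := by
      intro k
      induction k with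
      | zero => intro j hj; rw [hz j hj]; exact Even.zero
      | succ k ih =>
        intro j hj
        rw [colLen_eq_occupation_add]
        exact (h j).add (ih (j + 1) (by omega))
    exact fun j => key (lam.rowLen 0) j (by omega)

theorem occupation_injective : Function.Injective occupation := by
  intro lam mu h
  have hperm : lam.rowLens.Perm mu.rowLens := by
    rw [List.perm_iff_count]
    rintro (_ | i)
    · rw [List.count_eq_zero_of_not_mem fun h0 => (lam.pos_of_mem_rowLens 0 h0).false,
        List.count_eq_zero_of_not_mem fun h0 => (mu.pos_of_mem_rowLens 0 h0).false]
    · exact DFunLike.congr_fun h i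
  exact YoungDiagram.equivListRowLens.injective
    (Subtype.ext (hperm.eq_of_sortedGE lam.rowLens_sorted mu.rowLens_sorted))

theorem occupation_surjective : Function.Surjective occupation := by
  intro I
  let s : Multiset ℕ := Finsupp.toMultiset (I.embDomain ⟨Nat.succ, Nat.succ_injective⟩)
  have hs : ∀ i, s.count (i + 1) = I i := fun i => by
    rw [Finsupp.count_toMultiset]
    exact Finsupp.embDomain_apply_self ⟨Nat.succ, Nat.succ_injective⟩ I i
  have hpos : ∀ r ∈ s.sort (· ≥ ·), 0 < r := by
    intro r hr
    rw [Multiset.mem_sort, ← Multiset.count_pos, Finsupp.count_toMultiset] at hr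
    by_contra h0
    obtain rfl : r = 0 := by omega
    rw [Finsupp.embDomain_of_notMem_range _ _ _ (by simp)] at hr
    exact hr.false
  refine ⟨YoungDiagram.ofRowLens (s.sort (· ≥ ·)) (s.pairwise_sort (· ≥ ·)).sortedGE, ?_⟩
  ext i
  rw [occupation_apply, YoungDiagram.rowLens_ofRowLens_eq_self hpos, ← hs i, ← Multiset.coe_count,
    Multiset.sort_eq]

/-- Partitions with even conjugate correspond to occupations with even entries. -/
def evenEquiv : {lam : YoungDiagram // IsEvenPartition lam.transpose} ≃
    {I : Occupation // ∀ i, Even (I i)} :=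
  (Equiv.ofBijective occupation ⟨occupation_injective, occupation_surjective⟩).subtypeEquiv
    isEvenPartition_transpose_iff

theorem nonSkewF_eq_total {q s : ℂ} {n : ℕ} (x : Fin n → ℂ) (hx : ∀ i, s * x i ≠ 1)
    (lam : YoungDiagram) : nonSkewF q s lam x = total (List.ofFn x).reverse.length fun h =>
      rowsWeight q s (List.ofFn x).reverse h (occupation lam) := by
  rw [← foldr_rowOperator _ (by simpa [List.mem_ofFn] using hx), nonSkewF, skewF, ket,
    occupation_bot, List.foldr_reverse]

/-- The list is reversed because the last variable belongs to the bottom row; its head is the last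
variable, so the induction splits off the last index. -/
theorem pairProduct_reverse_ofFn (q : ℂ) {n : ℕ} (x : Fin n → ℂ) :
    pairProduct q (List.ofFn x).reverse =
      ∏ i : Fin n, ∏ j ∈ Ioi i, (1 - q * x i * x j) / (1 - x i * x j) := by
  have hI : ∀ (m : ℕ) (f : Fin m → ℂ) (i : Fin m),
      ∏ j ∈ Ioi i, f j = ∏ j, if i < j then f j else 1 := fun m f i => by
    rw [← prod_filter, filter_lt_eq_Ioi]
  simp only [hI]
  induction n with
  | zero => simp [pairProduct]
  | succ n ih =>
    rw [List.ofFn_succ', List.concat_eq_append, List.reverse_append, List.reverse_singleton,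
      List.singleton_append, pairProduct, ih, List.map_reverse, List.prod_reverse, List.map_ofFn,
      List.prod_ofFn, Fin.prod_univ_castSucc]
    simp only [Fin.prod_univ_castSucc, Fin.castSucc_lt_castSucc_iff, Fin.castSucc_lt_last, if_true,
      prod_mul_distrib, Function.comp_apply]
    have : ∀ j : Fin n, ¬ Fin.last n < j.castSucc := fun j => (Fin.castSucc_lt_last j).not_gt
    simp [this, mul_comm]

end SpinHallLittlewood

end

theorem corollary3p4 (q s : ℂ) (n : ℕ) (x : Fin n → ℂ)
    (hb : ∀ k : ℕ, 1 ≤ k → s ^ 2 * q ^ (2 * k - 1) ≠ 1)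
    (hx : ∀ i, s * x i ≠ 1)
    (hadm : ∀ i j, i < j →
      ‖(x i - s) * (x j - s)‖ < ‖(1 - s * x i) * (1 - s * x j)‖) :
    HasSum
      (fun lam : {lam : YoungDiagram // SpinHallLittlewood.IsEvenPartition lam.transpose} =>
        SpinHallLittlewood.bEl q s lam.1 * SpinHallLittlewood.nonSkewF q s lam.1 x)
      (∏ i : Fin n, ∏ j ∈ Finset.Ioi i, (1 - q * x i * x j) / (1 - x i * x j)) := by
  have hne : (List.ofFn x).reverse.Pairwise fun y z => z * y ≠ 1 := by
    rw [List.pairwise_reverse, List.pairwise_ofFn]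
    intro i j hij h
    refine (hadm i j hij).ne (congrArg norm ?_)
    -- The identity `(xᵢ - s)(xⱼ - s) - (1 - s xᵢ)(1 - s xⱼ) = (1 - s²)(xᵢ xⱼ - 1)` shows that `xᵢ
    -- xⱼ = 1` would contradict the strict inequality.
    linear_combination (1 - s ^ 2) * h
  have hadm' : (List.ofFn x).reverse.Pairwise fun y z =>
      ‖(y - s) / (1 - s * y) * ((z - s) / (1 - s * z))‖ < 1 := by
    rw [List.pairwise_reverse, List.pairwise_ofFn]
    intro i j hij
    have h := hadm i j hij
    rw [div_mul_div_comm, norm_div, div_lt_one ((norm_nonneg _).trans_lt (by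
      rwa [mul_comm (1 - s * x j)])), mul_comm, mul_comm (1 - s * x j)]
    exact h
  have h := SpinHallLittlewood.hasSum_even hb (by simpa [List.mem_ofFn] using hx) hadm' hne
  rw [SpinHallLittlewood.pairProduct_reverse_ofFn,
    ← SpinHallLittlewood.evenEquiv.hasSum_iff] at h
  refine h.congr_fun fun lam => ?_
  rw [SpinHallLittlewood.nonSkewF_eq_total x hx]
  rfl
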